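/- Let $p \ge 1$ be odd, let $m \ge 1$ be a multiple of $p$ with $m \neq p$, and put $q = m/p$. Let $H = G(m,p,2) \subset GL_2(\mathbb{C})$ be the group of all matrices $PD$, where $P$ is a permutation matrix and $D$ is a diagonal matrix whose entries are $m$-th roots of unity and which satisfies $\det(D)^{m/p}=1$. It acts on $S = \mathbb{C}[x,y]$ by linear substitutions; let $R = S^H$ be the invariant ring and let $\sigma_1 = (xy)^q$, $\sigma_2 = x^m+y^m$, $\Delta = \sigma_1(\sigma_2^2-4\sigma_1^p)$, which are elements of $R$. For every reflecting hyperplane $W$ of $H$ (a hyperplane of $\mathbb{C}^2$ fixed pointwise by some $g \neq 1$ in $H$) choose a linear form $\alpha_W \in S$ with kernel $W$, let $e_W$ be the order of the pointwise stabiliser of $W$ in $H$, and put $z = \prod_W \alpha_W$. For $0 \le j \le p$ let $$\phi_j= \begin{pmatrix} \sigma_2 & 2\sigma_1^j \\ 2\sigma_1^{p-j} & \sigma_2 \end{pmatrix},\quad \psi_j = \begin{pmatrix} \sigma_2\sigma_1 & -2\sigma_1^{j+1} \\ -2\sigma_1^{p+1-j} & \sigma_2\sigma_1 \end{pmatrix},\quad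 \xi_j=\begin{pmatrix}\sigma_2 & 2\sigma_1^j \\ 2\sigma_1^{p+1-j} & \sigma_2\sigma_1 \end{pmatrix},$$ and let $K_j$, $N_j$, $X_j$ be the cokernels of $\phi_j$, $\psi_j$, $\xi_j : R^2 \to R^2$, respectively. Then $\prod_W \alpha_W^{e_W}$ equals $\Delta$ up to a non-zero constant, $S/(z)$ and all the modules below are annihilated by $\Delta$, and as modules over $R/(\Delta)$ $$S/(z) \cong \bigoplus_{j=1}^{p}X_j^{2(q-1)} \oplus \bigoplus_{j=1}^{(p-1)/2} N_j^2 \oplus \bigoplus_{j=1}^{(p-1)/2}K_j^{2(q-1)^{2}} \oplus K_0^{2\binom{q-1}{2}} \oplus R/(\sigma_1)\oplus \bigl(R/(\sigma_2^2 - 4\sigma_1^p)\bigr)^{q-1} \oplus R/(\Delta)$$ $$\cong \bigoplus_{j=1}^{p}X_j^{2(q-1)} \oplus \bigoplus_{j=1}^{(p-1)/2} N_j^2 \oplus \bigoplus_{j=1}^{(p-1)/2}K_j^{2(q-1)^{2}} \oplus R/(\sigma_1)\oplus \bigl(R/(\sigma_2^2 - 4\sigma_1^p)\bigr)^{q-1+2\binom{q-1}{2}}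 \oplus R/(\Delta).$$ -/

import Mathlib

open scoped DirectSum

noncomputable section

namespace ReflGroup

/-- The group `G(m,p,n)`: all matrices `P D`, where `P` is a permutation matrix and `D` is a
diagonal matrix whose entries are `m`-th roots of unity and which satisfies
`det(D)^(m/p) = 1`. -/
def G (m p n : ℕ) : Subgroup (GL (Fin n) ℂ) where
  carrier := {g | ∃ (σ : Equiv.Perm (Fin n)) (d : Fin n → ℂ),
    (∀ i, d i ^ m = 1) ∧ (Matrix.diagonal d).det ^ (m / p) = 1 ∧
    (g : Matrix (Fin n) (Fin n) ℂ) = σ.permMatrix ℂ * Matrix.diagonal d}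
  one_mem' := ⟨1, 1, by simp, by simp, by simp⟩
  mul_mem' := by
    rintro g h ⟨σ, d, hd, hd', hg⟩ ⟨τ, e, he, he', hh⟩
    refine ⟨τ * σ, fun k => d (τ⁻¹ k) * e k, fun i => ?_, ?_, ?_⟩
    · rw [mul_pow, hd, he, one_mul]
    · rw [Matrix.det_diagonal] at *
      rw [Finset.prod_mul_distrib, Equiv.prod_comp τ⁻¹ d, mul_pow, hd', he', one_mul]
    · rw [Units.val_mul, hg, hh]
      ext i j
      simp only [Matrix.mul_apply, Equiv.Perm.permMatrix,
        PEquiv.toMatrix_apply, Equiv.toPEquiv_apply, Option.mem_some_iff, Equiv.Perm.mul_apply]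
      rw [Finset.sum_eq_single (σ i) (fun k _ hk => by simp [hk.symm]) (by simp)]
      by_cases hij : τ (σ i) = j
      · subst hij
        simp
      · simp [hij]
  inv_mem' := by
    rintro g ⟨σ, d, hd, hd', hg⟩
    have hd0 : (∀ i, d i ≠ 0) := by
      intro i h0
      have hu : IsUnit (g : Matrix (Fin n) (Fin n) ℂ).det :=
        (Matrix.isUnit_iff_isUnit_det _).mp g.isUnit
      rw [hg, Matrix.det_mul, Matrix.det_diagonal, Finset.prod_eq_zero (Finset.mem_univ i) h0,
        mul_zero] at hu
      exact not_isUnit_zero hu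
    refine ⟨σ⁻¹, fun i => (d (σ i))⁻¹, fun i => ?_, ?_, ?_⟩
    · rw [inv_pow, hd, inv_one]
    · rw [Matrix.det_diagonal] at *
      rw [Finset.prod_inv_distrib, Equiv.prod_comp σ d, inv_pow, hd', inv_one]
    · rw [Matrix.coe_units_inv, hg]
      apply Matrix.inv_eq_left_inv
      ext i j
      rw [Matrix.mul_apply, Finset.sum_eq_single (σ⁻¹ i)]
      · by_cases hij : i = j
        · subst hij
          simp [Matrix.mul_diagonal, Equiv.Perm.permMatrix, PEquiv.toMatrix_apply, hd0]
        · simp [Matrix.mul_diagonal, Equiv.Perm.permMatrix, PEquiv.toMatrix_apply, hij]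
      · intro k _ hk
        have hk' : ¬ Equiv.symm σ i = k := fun h => hk h.symm
        simp [Matrix.mul_diagonal, Equiv.Perm.permMatrix, PEquiv.toMatrix_apply, hk']
      · simp

/-- The linear substitution `x_i ↦ ∑_j g_{ij} x_j`: on polynomial functions on `ℂⁿ` it is
`f ↦ f ∘ g`. -/
def subst {n : ℕ} (g : GL (Fin n) ℂ) : MvPolynomial (Fin n) ℂ →ₐ[ℂ] MvPolynomial (Fin n) ℂ :=
  MvPolynomial.aeval fun i => ∑ j, MvPolynomial.C (g i j) * MvPolynomial.X j

/-- The invariant ring `S^G` of a matrix group `G` acting on `S = ℂ[x_1, …, x_n]`. -/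
def invariants {n : ℕ} (G : Subgroup (GL (Fin n) ℂ)) :
    Subalgebra ℂ (MvPolynomial (Fin n) ℂ) where
  carrier := {f | ∀ g ∈ G, subst g f = f}
  mul_mem' := fun ha hb g hg => by rw [map_mul, ha g hg, hb g hg]
  add_mem' := fun ha hb g hg => by rw [map_add, ha g hg, hb g hg]
  algebraMap_mem' := fun r g _ => (subst g).commutes r

/-- The reflecting hyperplanes of a finite matrix group `G`: the hyperplanes of `ℂⁿ` that are fixed
pointwise by some `g ≠ 1` in `G` (such a `g` has finite order, so it is diagonalisable). -/
def hyperplanes {n : ℕ} (G : Subgroup (GL (Fin n) ℂ)) : Set (Submodule ℂ (Fin n → ℂ)) :=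
  {W | Module.finrank ℂ W + 1 = n ∧
    ∃ g ∈ G, g ≠ 1 ∧ ∀ v ∈ W, (g : Matrix (Fin n) (Fin n) ℂ).mulVec v = v}

/-- `e_W`, the order of the pointwise stabiliser of `W` in `G`. -/
def fixerOrder {n : ℕ} (G : Subgroup (GL (Fin n) ℂ)) (W : Submodule ℂ (Fin n → ℂ)) : ℕ :=
  Nat.card {g : GL (Fin n) ℂ //
    g ∈ G ∧ ∀ v ∈ W, (g : Matrix (Fin n) (Fin n) ℂ).mulVec v = v}

/-- `ℓ` is a linear form with `W = ker ℓ`. -/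
def IsDefiningForm {n : ℕ} (W : Submodule ℂ (Fin n → ℂ)) (l : MvPolynomial (Fin n) ℂ) : Prop :=
  l.IsHomogeneous 1 ∧ ∀ v, v ∈ W ↔ MvPolynomial.eval v l = 0

/-- `z = ∏_W α_W`, the product over all reflecting hyperplanes `W` of `G`. -/
def arrangementPoly {n : ℕ} (G : Subgroup (GL (Fin n) ℂ))
    (α : Submodule ℂ (Fin n → ℂ) → MvPolynomial (Fin n) ℂ) : MvPolynomial (Fin n) ℂ :=
  ∏ᶠ W ∈ hyperplanes G, α W

/-- `δ = ∏_W α_W ^ e_W`, the discriminant of the group action. -/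
def discriminantPoly {n : ℕ} (G : Subgroup (GL (Fin n) ℂ))
    (α : Submodule ℂ (Fin n → ℂ) → MvPolynomial (Fin n) ℂ) : MvPolynomial (Fin n) ℂ :=
  ∏ᶠ W ∈ hyperplanes G, α W ^ fixerOrder G W

/-- `S = ℂ[x, y]`, with `x = X 0` and `y = X 1`. -/
abbrev S : Type := MvPolynomial (Fin 2) ℂ

/-- `R = S^H` for `H = G(m,p,2)`. -/
def R (m p : ℕ) : Type := invariants (G m p 2)

instance (m p : ℕ) : CommRing (R m p) := inferInstanceAs (CommRing (invariants (G m p 2)))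

instance (m p : ℕ) : Algebra ℂ (R m p) := inferInstanceAs (Algebra ℂ (invariants (G m p 2)))

/-- `S` is an algebra over `R` by the inclusion `R ⊆ S`. -/
instance (m p : ℕ) : Algebra (R m p) S := inferInstanceAs (Algebra (invariants (G m p 2)) S)

theorem subst_cases {m p : ℕ} {g : GL (Fin 2) ℂ} (hg : g ∈ G m p 2) :
    ∃ a b : ℂ, a ^ m = 1 ∧ b ^ m = 1 ∧ (a * b) ^ (m / p) = 1 ∧
      ((subst g (MvPolynomial.X 0) = MvPolynomial.C a * MvPolynomial.X 0 ∧
        subst g (MvPolynomial.X 1) = MvPolynomial.C b * MvPolynomial.X 1) ∨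
       (subst g (MvPolynomial.X 0) = MvPolynomial.C b * MvPolynomial.X 1 ∧
        subst g (MvPolynomial.X 1) = MvPolynomial.C a * MvPolynomial.X 0)) := by
  obtain ⟨σ, d, hd, hd', hg⟩ := hg
  refine ⟨d 0, d 1, hd 0, hd 1, by simpa using hd', ?_⟩
  have hσ : σ = 1 ∨ σ = Equiv.swap 0 1 := by
    clear hg
    revert σ
    decide
  rcases hσ with rfl | rfl
  · left
    simp [subst, hg]
  · right
    simp [subst, hg, Equiv.Perm.permMatrix, PEquiv.toMatrix_apply]

/-- `σ₁ = (xy)^q`, where `q = m/p`. -/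
def σ₁ (m p : ℕ) : R m p :=
  ⟨(MvPolynomial.X 0 * MvPolynomial.X 1) ^ (m / p), by
    intro g hg
    obtain ⟨a, b, -, -, hab, ⟨h0, h1⟩ | ⟨h0, h1⟩⟩ := subst_cases hg
    · rw [map_pow, map_mul, h0, h1, mul_mul_mul_comm, mul_pow, ← MvPolynomial.C_mul,
        ← MvPolynomial.C_pow, hab, MvPolynomial.C_1, one_mul]
    · rw [map_pow, map_mul, h0, h1, mul_mul_mul_comm, mul_pow, ← MvPolynomial.C_mul,
        ← MvPolynomial.C_pow, mul_comm b a, hab, MvPolynomial.C_1, one_mul,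
        mul_comm (MvPolynomial.X 1)]⟩

/-- `σ₂ = x^m + y^m`. -/
def σ₂ (m p : ℕ) : R m p :=
  ⟨MvPolynomial.X 0 ^ m + MvPolynomial.X 1 ^ m, by
    intro g hg
    obtain ⟨a, b, ha, hb, -, ⟨h0, h1⟩ | ⟨h0, h1⟩⟩ := subst_cases hg
    · rw [map_add, map_pow, map_pow, h0, h1, mul_pow, mul_pow, ← MvPolynomial.C_pow,
        ← MvPolynomial.C_pow, ha, hb, MvPolynomial.C_1, one_mul, one_mul]
    · rw [map_add, map_pow, map_pow, h0, h1, mul_pow, mul_pow, ← MvPolynomial.C_pow,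
        ← MvPolynomial.C_pow, ha, hb, MvPolynomial.C_1, one_mul, one_mul, add_comm]⟩

/-- The discriminant `Δ = σ₁(σ₂² - 4σ₁^p)`, an element of `R`. -/
def Δ (m p : ℕ) : R m p := σ₁ m p * (σ₂ m p ^ 2 - 4 * σ₁ m p ^ p)

/-- The cokernel of a matrix factorization `(φ, ψ)` is the cokernel of the map
`φ : Rⁿ → Rⁿ` on column vectors. -/
abbrev Coker {A : Type*} [CommRing A] {n : ℕ} (φ : Matrix (Fin n) (Fin n) A) : Type _ :=
  (Fin n → A) ⧸ LinearMap.range φ.mulVecLin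

/-- The first matrix of the matrix factorization `(φ_j, ψ_j)` of `Δ`, `0 ≤ j ≤ p`. -/
def φ (m p j : ℕ) : Matrix (Fin 2) (Fin 2) (R m p) :=
  !![σ₂ m p, 2 * σ₁ m p ^ j; 2 * σ₁ m p ^ (p - j), σ₂ m p]

/-- The second matrix of the matrix factorization `(φ_j, ψ_j)` of `Δ`, `0 ≤ j ≤ p`. -/
def ψ (m p j : ℕ) : Matrix (Fin 2) (Fin 2) (R m p) :=
  !![σ₂ m p * σ₁ m p, -2 * σ₁ m p ^ (j + 1); -2 * σ₁ m p ^ (p + 1 - j), σ₂ m p * σ₁ m p]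

/-- The first matrix of the matrix factorization `(ξ_j, η_j)` of `Δ`, `0 ≤ j ≤ p`. -/
def ξ (m p j : ℕ) : Matrix (Fin 2) (Fin 2) (R m p) :=
  !![σ₂ m p, 2 * σ₁ m p ^ j; 2 * σ₁ m p ^ (p + 1 - j), σ₂ m p * σ₁ m p]

/-- The second matrix of the matrix factorization `(ξ_j, η_j)` of `Δ`, `0 ≤ j ≤ p`. -/
def η (m p j : ℕ) : Matrix (Fin 2) (Fin 2) (R m p) :=
  !![σ₂ m p * σ₁ m p, -2 * σ₁ m p ^ j; -2 * σ₁ m p ^ (p + 1 - j), σ₂ m p]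

theorem φ_mul_ψ (m p j : ℕ) (hj : j ≤ p) : φ m p j * ψ m p j = Δ m p • 1 := by
  obtain ⟨k, rfl⟩ := Nat.exists_eq_add_of_le hj
  have h1 : j + k - j = k := by omega
  have h2 : j + k + 1 - j = k + 1 := by omega
  ext i l : 1
  fin_cases i <;> fin_cases l <;>
    simp [φ, ψ, Δ, h1, h2, Matrix.mul_apply, Fin.sum_univ_two] <;> ring

theorem ξ_mul_η (m p j : ℕ) (hj : j ≤ p) : ξ m p j * η m p j = Δ m p • 1 := by
  obtain ⟨k, rfl⟩ := Nat.exists_eq_add_of_le hj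
  have h2 : j + k + 1 - j = k + 1 := by omega
  ext i l : 1
  fin_cases i <;> fin_cases l <;>
    simp [ξ, η, Δ, h2, Matrix.mul_apply, Fin.sum_univ_two] <;> ring

/-- `X_j = Coker(ξ_j, η_j)`. -/
abbrev X (m p j : ℕ) : Type := Coker (ξ m p j)

/-- `K_j = Coker(φ_j, ψ_j)`. -/
abbrev K (m p j : ℕ) : Type := Coker (φ m p j)

/-- `N_j = Coker(ψ_j, φ_j)`. -/
abbrev N (m p j : ℕ) : Type := Coker (ψ m p j)

/-- The `A`-modules `M` and `M'` are annihilated by the ideal `I`, hence modules over `A/I`, and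
they are isomorphic as `A/I`-modules. -/
def IsoOverQuotient {A : Type*} [CommRing A] (I : Ideal A) (M M' : Type*)
    [AddCommGroup M] [Module A M] [AddCommGroup M'] [Module A M'] : Prop :=
  ∃ (h : Module.IsTorsionBySet A M I) (h' : Module.IsTorsionBySet A M' I),
    letI := h.module
    letI := h'.module
    Nonempty (M ≃ₗ[A ⧸ I] M')

end ReflGroup

end

/-!
The diagonal matrices in `H = G(m,p,2)` form a group with character group `ℤ/q × ℤ/m`, and `S` is
graded by it with `R` in degree `0`. Each isotypic component of `S` is free of rank two over `R`,
with basis `xᵃ yᵇ x^(q(p-e))`, `xᵃ yᵇ y^(qe)` for suitable `a, b < q` and `e ≤ p`. Up to a unit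
`z = xy(xᵐ - yᵐ)`, so multiplication by `z` carries isotypic components to isotypic components. In
the above bases it is given by `2 × 2` matrices, and row and column operations turn these into the
`φ_j`, `ψ_j` and `ξ_j`. The summands with indices `j` and `p - j` are isomorphic, which
accounts for the exponents, and those with `j = 0` are sums of cyclic modules because `2` is
invertible.
-/

noncomputable section

namespace ReflGroup

open MvPolynomial (C coeff monomial)

/-! ### Monomial matrices -/

section MonomialMatrices

variable {n : ℕ}

/-- The monomial matrix `P D`, where `P` is the permutation matrix of `σ` and `D` is the diagonal
matrix with entries `u`. The elements of `G(m,p,n)` are of this form. -/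
def monomialGL (σ : Equiv.Perm (Fin n)) (u : Fin n → ℂˣ) : GL (Fin n) ℂ :=
  Matrix.GeneralLinearGroup.mkOfDetNeZero
    (σ.permMatrix ℂ * Matrix.diagonal fun i => (u i : ℂ)) (by
      simp [Matrix.det_permutation, Finset.prod_ne_zero_iff])

theorem coe_monomialGL (σ : Equiv.Perm (Fin n)) (u : Fin n → ℂˣ) :
    (monomialGL σ u : Matrix (Fin n) (Fin n) ℂ) =
      σ.permMatrix ℂ * Matrix.diagonal fun i => (u i : ℂ) :=
  rfl

theorem monomialGL_mulVec (σ : Equiv.Perm (Fin n)) (u : Fin n → ℂˣ) (v : Fin n → ℂ) (i : Fin n) :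
    (monomialGL σ u : Matrix (Fin n) (Fin n) ℂ).mulVec v i = u (σ i) * v (σ i) := by
  rw [coe_monomialGL, ← Matrix.mulVec_mulVec, Matrix.permMatrix_mulVec]
  simp [Matrix.mulVec_diagonal]

theorem monomialGL_one_one : monomialGL (1 : Equiv.Perm (Fin n)) 1 = 1 :=
  Units.ext (by simp [coe_monomialGL])

theorem monomialGL_one_injective :
    Function.Injective (monomialGL (1 : Equiv.Perm (Fin n))) := fun u v h => funext fun i => by
  have h := congrArg (fun g : GL (Fin n) ℂ => g.1.mulVec 1 i) h
  simpa [monomialGL_mulVec, Units.ext_iff] using h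

theorem monomialGL_swap_ne_one (u : Fin 2 → ℂˣ) : monomialGL (Equiv.swap 0 1) u ≠ 1 := fun h => by
  have h := congrArg (fun g : GL (Fin 2) ℂ => g.1.mulVec (Pi.single 0 1) 0) h
  simp [monomialGL_mulVec] at h

theorem mem_G_iff {m p : ℕ} [NeZero m] {g : GL (Fin n) ℂ} :
    g ∈ G m p n ↔ ∃ (σ : Equiv.Perm (Fin n)) (u : Fin n → ℂˣ),
      (∀ i, u i ^ m = 1) ∧ (∏ i, u i) ^ (m / p) = 1 ∧ g = monomialGL σ u := by
  constructor
  · rintro ⟨σ, d, hd, hdet, hg⟩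
    have hu (i : Fin n) : ∃ v : ℂˣ, (v : ℂ) = d i := IsUnit.of_pow_eq_one (hd i) (NeZero.ne m)
    choose u hu using hu
    obtain rfl : (fun i => (u i : ℂ)) = d := funext hu
    refine ⟨σ, u, fun i => Units.ext (hd i), Units.ext ?_, Units.ext hg⟩
    simpa using hdet
  · rintro ⟨σ, u, hu, hdet, rfl⟩
    refine ⟨σ, fun i => u i, fun i => congrArg Units.val (hu i), ?_, coe_monomialGL σ u⟩
    simpa using congrArg Units.val hdet

theorem subst_monomialGL_X (σ : Equiv.Perm (Fin n)) (u : Fin n → ℂˣ) (i : Fin n) :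
    subst (monomialGL σ u) (MvPolynomial.X i) = C (u (σ i) : ℂ) * MvPolynomial.X (σ i) := by
  simp [subst, coe_monomialGL, Equiv.Perm.permMatrix, PEquiv.toMatrix_apply, apply_ite C]

theorem coeff_subst_monomialGL_one (u : Fin n → ℂˣ) (f : MvPolynomial (Fin n) ℂ)
    (d : Fin n →₀ ℕ) :
    coeff d (subst (monomialGL 1 u) f) = (∏ i, u i ^ d i : ℂˣ) * coeff d f := by
  induction f using MvPolynomial.induction_on' with
  | add f₁ f₂ h₁ h₂ => rw [map_add, MvPolynomial.coeff_add, h₁, h₂, MvPolynomial.coeff_add, mul_add]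
  | monomial e c =>
    have hsubst : subst (monomialGL 1 u) (monomial e c) =
        monomial e ((∏ i, u i ^ e i : ℂˣ) * c) := by
      rw [MvPolynomial.monomial_eq, MvPolynomial.monomial_eq, Finsupp.prod_fintype _ _ (by simp)]
      simp [subst_monomialGL_X, mul_pow, Finset.prod_mul_distrib, MvPolynomial.algHom_C]
      ring
    rw [hsubst, MvPolynomial.coeff_monomial, MvPolynomial.coeff_monomial]
    split_ifs with h
    · rw [h]
    · simp

end MonomialMatrices

/-! ### The grading of `S` by the characters of the diagonal subgroup -/

theorem prod_pow_eq_one_of_coeff_ne_zero {m p n : ℕ} [NeZero m] {f : MvPolynomial (Fin n) ℂ}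
    (hf : f ∈ invariants (G m p n)) {d : Fin n →₀ ℕ} (hd : coeff d f ≠ 0) {u : Fin n → ℂˣ}
    (hu : ∀ i, u i ^ m = 1) (hdet : (∏ i, u i) ^ (m / p) = 1) : ∏ i, u i ^ d i = 1 := by
  have h := coeff_subst_monomialGL_one u f d
  rw [hf _ (mem_G_iff.2 ⟨1, u, hu, hdet, rfl⟩)] at h
  exact Units.ext (mul_right_cancel₀ hd (by rw [Units.val_one, one_mul, ← h]))

theorem exists_units_isPrimitiveRoot (k : ℕ) [NeZero k] : ∃ ζ : ℂˣ, IsPrimitiveRoot ζ k :=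
  ⟨_, (Complex.isPrimitiveRoot_exp k (NeZero.ne k)).isUnit_unit (NeZero.ne k)⟩

/-- The variable `x` of `S = ℂ[x, y]`. -/
abbrev varX : S := MvPolynomial.X 0

/-- The variable `y` of `S = ℂ[x, y]`. -/
abbrev varY : S := MvPolynomial.X 1

theorem subst_algebraMap {m p : ℕ} {g : GL (Fin 2) ℂ} (hg : g ∈ G m p 2) (r : R m p) :
    subst g (algebraMap (R m p) S r) = algebraMap (R m p) S r :=
  r.2 g hg

theorem algebraMap_injective (m p : ℕ) : Function.Injective (algebraMap (R m p) S) :=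
  Subtype.val_injective

theorem algebraMap_σ₁ (p q : ℕ) [NeZero p] :
    algebraMap (R (p * q) p) S (σ₁ (p * q) p) = varX ^ q * varY ^ q := by
  have hdiv : p * q / p = q := Nat.mul_div_cancel_left q (NeZero.pos p)
  calc algebraMap (R (p * q) p) S (σ₁ (p * q) p) = (varX * varY) ^ (p * q / p) := rfl
    _ = varX ^ q * varY ^ q := by rw [hdiv, mul_pow]

theorem algebraMap_σ₂ (m p : ℕ) : algebraMap (R m p) S (σ₂ m p) = varX ^ m + varY ^ m :=
  rfl

/-- The weights of `x` and `y` in the character group `ℤ/q × ℤ/m` of the diagonal subgroup of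
`G(m,p,2)`, `m = pq`: a character is recorded by its values at `diag(η, 1)` and `diag(ω, ω⁻¹)`,
where `η` and `ω` are primitive roots of unity of orders `q` and `m`. -/
def weight (m q : ℕ) : Fin 2 → ZMod q × ZMod m := ![(1, 1), (0, -1)]

theorem isWeightedHomogeneous_algebraMap (p q : ℕ) [NeZero p] [NeZero q] (r : R (p * q) p) :
    MvPolynomial.IsWeightedHomogeneous (weight (p * q) q) (algebraMap (R (p * q) p) S r) 0 := by
  intro d hd
  have hdiv : p * q / p = q := Nat.mul_div_cancel_left q (NeZero.pos p)
  have hchar (u : Fin 2 → ℂˣ) := prod_pow_eq_one_of_coeff_ne_zero r.2 hd (u := u)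
  simp only [hdiv, Fin.forall_fin_two, Fin.prod_univ_two] at hchar
  have hη : q ∣ d 0 := by
    obtain ⟨η, hη⟩ := exists_units_isPrimitiveRoot q
    have h := hchar ![η, 1] (by simp [mul_comm p, pow_mul, hη.pow_eq_one]) (by simp [hη.pow_eq_one])
    exact hη.dvd_of_pow_eq_one _ (by simpa using h)
  have hω : (d 0 : ZMod (p * q)) = d 1 := by
    obtain ⟨ω, hω⟩ := exists_units_isPrimitiveRoot (p * q)
    have h := hchar ![ω, ω⁻¹] (by simp [hω.pow_eq_one]) (by simp)
    have hz : ω ^ ((d 0 : ℤ) - d 1) = 1 := by simpa [zpow_sub, ← inv_pow] using h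
    have hdvd := (ZMod.intCast_zmod_eq_zero_iff_dvd _ _).2 ((hω.zpow_eq_one_iff_dvd _).1 hz)
    exact sub_eq_zero.1 (by exact_mod_cast hdvd)
  rw [Finsupp.weight_apply, Finsupp.sum_fintype _ _ (by simp)]
  ext <;> simp [weight, hω, (ZMod.natCast_eq_zero_iff _ _).2 hη]

/-! ### A basis of `S` over `R` -/

section TwoGenerators

variable {A B : Type*} [CommRing A] [CommRing B] [Algebra A B] {P : Submodule A B} {u v w : B}
  {s₁ s₂ : A} {p : ℕ}

theorem mul_pow_mul_pow_mem_of_lt (h₁ : algebraMap A B s₁ = u * v) {k : ℕ}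
    (hu : ∀ i < k, w * u ^ i ∈ P) (hv : ∀ i < k, w * v ^ i ∈ P) {a b : ℕ} (ha : a < k)
    (hb : b < k) : w * (u ^ a * v ^ b) ∈ P := by
  induction a generalizing b with
  | zero => simpa using hv b hb
  | succ a ih =>
    cases b with
    | zero => simpa using hu (a + 1) ha
    | succ b =>
      have h := P.smul_mem s₁ (ih (by omega) (b := b) (by omega))
      rw [Algebra.smul_def, h₁] at h
      convert h using 1
      ring

theorem mul_pow_mem (h₁ : algebraMap A B s₁ = u * v) (h₂ : algebraMap A B s₂ = u ^ p + v ^ p)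
    (hp : 0 < p) (hu : ∀ k ≤ p, w * u ^ k ∈ P) (hv : ∀ k ≤ p, w * v ^ k ∈ P) (k : ℕ) :
    w * u ^ k ∈ P ∧ w * v ^ k ∈ P := by
  induction k using Nat.strong_induction_on with
  | _ k ih =>
    rcases le_or_gt k p with hk | hk
    · exact ⟨hu k hk, hv k hk⟩
    obtain ⟨l, rfl⟩ := Nat.exists_eq_add_of_lt hk
    have hmixed {a b : ℕ} :=
      mul_pow_mul_pow_mem_of_lt (a := a) (b := b) h₁ (fun i hi => (ih i hi).1)
      fun i hi => (ih i hi).2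
    have hu' := P.sub_mem (P.smul_mem s₂ (ih (l + 1) (by omega)).1)
      (hmixed (a := l + 1) (b := p) (by omega) hk)
    have hv' := P.sub_mem (P.smul_mem s₂ (ih (l + 1) (by omega)).2)
      (hmixed (a := p) (b := l + 1) hk (by omega))
    rw [Algebra.smul_def, h₂] at hu' hv'
    constructor
    · convert hu' using 1
      ring
    · convert hv' using 1
      ring

theorem mul_pow_mul_pow_mem (h₁ : algebraMap A B s₁ = u * v)
    (h₂ : algebraMap A B s₂ = u ^ p + v ^ p) (hp : 0 < p) (hu : ∀ k < p, w * u ^ k ∈ P)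
    (hv : ∀ k < p, w * v ^ k ∈ P) (huv : w * u ^ p ∈ P ∨ w * v ^ p ∈ P) (a b : ℕ) :
    w * (u ^ a * v ^ b) ∈ P := by
  have hsum : w * u ^ p + w * v ^ p ∈ P := by
    have h := P.smul_mem s₂ (hu 0 hp)
    rw [Algebra.smul_def, h₂] at h
    convert h using 1
    ring
  have hup : w * u ^ p ∈ P := huv.elim id fun h => (P.add_mem_iff_left h).1 hsum
  have hvp : w * v ^ p ∈ P := (P.add_mem_iff_right hup).1 hsum
  have hpow := mul_pow_mem h₁ h₂ hp
    (fun k hk => hk.lt_or_eq.elim (hu k) fun h => h ▸ hup)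
    fun k hk => hk.lt_or_eq.elim (hv k) fun h => h ▸ hvp
  exact mul_pow_mul_pow_mem_of_lt (k := a + b + 1) h₁ (fun i _ => (hpow i).1)
    (fun i _ => (hpow i).2) (by omega) (by omega)

theorem eq_zero_of_smul_pow_add_smul_pow_eq_zero [IsDomain B] [FaithfulSMul A B] {F : Type*}
    [FunLike F B B] [RingHomClass F B B] {τ : F}
    (hτ : ∀ r : A, τ (algebraMap A B r) = algebraMap A B r)
    (hu : τ u = v) (hv : τ v = u) (huv : u ^ p ≠ v ^ p) {e : ℕ} (he : e ≤ p) {r s : A}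
    (h : r • u ^ (p - e) + s • v ^ e = 0) : r = 0 ∧ s = 0 := by
  have h' : r • v ^ (p - e) + s • u ^ e = 0 := by
    simpa [Algebra.smul_def, hτ, hu, hv] using congrArg τ h
  obtain ⟨l, rfl⟩ := Nat.exists_eq_add_of_le he
  rw [Nat.add_sub_cancel_left, Algebra.smul_def, Algebra.smul_def] at h h'
  have hr : algebraMap A B r * (u ^ (e + l) - v ^ (e + l)) = 0 := by
    linear_combination u ^ e * h - v ^ e * h'
  have hs : algebraMap A B s * (u ^ (e + l) - v ^ (e + l)) = 0 := by
    linear_combination u ^ l * h' - v ^ l * h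
  simpa [sub_ne_zero.2 huv] using And.intro hr hs

end TwoGenerators

theorem linearIndependent_prod_of_isWeightedHomogeneous {A k σ M ι κ : Type*} [CommRing A]
    [CommRing k] [AddCommMonoid M] [Algebra A (MvPolynomial σ k)] [Finite ι] [Finite κ]
    {wt : σ → M} (hA : ∀ r : A, (algebraMap A (MvPolynomial σ k) r).IsWeightedHomogeneous wt 0)
    {w : ι → M} (hw : Function.Injective w) {f : ι → κ → MvPolynomial σ k}
    (hf : ∀ i j, (f i j).IsWeightedHomogeneous wt (w i))
    (hli : ∀ i, LinearIndependent A (f i)) :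
    LinearIndependent A fun t : ι × κ => f t.1 t.2 := by
  have := Fintype.ofFinite ι
  have := Fintype.ofFinite κ
  have hhom (i : ι) (j : κ) (r : A) : (r • f i j).IsWeightedHomogeneous wt (w i) := by
    simpa [Algebra.smul_def] using (hA r).mul (hf i j)
  refine Fintype.linearIndependent_iff.2 fun r hr ⟨i, j⟩ => ?_
  refine Fintype.linearIndependent_iff.1 (hli i) (fun j => r (i, j)) ?_ j
  have hcomp := congrArg (MvPolynomial.weightedHomogeneousComponent wt (w i)) hr
  rw [map_sum, map_zero, Fintype.sum_prod_type, Fintype.sum_eq_single i] at hcomp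
  · simpa only [(hhom i _ _).weightedHomogeneousComponent_same] using hcomp
  · intro i' hi'
    exact Finset.sum_eq_zero fun j _ =>
      (hhom i' j _).weightedHomogeneousComponent_ne _ fun h => hi' (hw h.symm)

section Basis

variable {p q : ℕ}

/-- The homogeneous pair `x^a y^b x^{q(p-e)}`, `x^a y^b y^{qe}`, where `e = c + δ a b`. Both members
have the weight `isotypicWeight δ (a, b, c)`, and they form a basis of the corresponding isotypic
component of `S` over `R`. Each of `e = 0` and `e = p` describes the component of `x^a y^b`; the
shift `δ` decides which of the two is used. -/
def isotypicPair (δ : Fin q → Fin q → Fin 2) (t : Fin q × Fin q × Fin p) : Fin 2 → S :=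
  ![varX ^ (t.1 : ℕ) * varY ^ (t.2.1 : ℕ) * (varX ^ q) ^ (p - (t.2.2 + δ t.1 t.2.1)),
    varX ^ (t.1 : ℕ) * varY ^ (t.2.1 : ℕ) * (varY ^ q) ^ (t.2.2 + δ t.1 t.2.1 : ℕ)]

/-- The common weight of the two members of `isotypicPair δ t`. -/
def isotypicWeight (δ : Fin q → Fin q → Fin 2) (t : Fin q × Fin q × Fin p) :
    ZMod q × ZMod (p * q) :=
  ((t.1 : ℕ), (t.1 : ℕ) - ((t.2.1 + q * (t.2.2 + δ t.1 t.2.1) : ℕ) : ZMod (p * q)))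

theorem add_shift_le (c : Fin p) (d : Fin 2) : (c : ℕ) + d ≤ p := by
  omega

theorem isWeightedHomogeneous_varX_pow_mul_varY_pow (m q i j : ℕ) :
    (varX ^ i * varY ^ j).IsWeightedHomogeneous (weight m q)
      ((i : ZMod q), (i : ZMod m) - (j : ZMod m)) := by
  convert ((MvPolynomial.isWeightedHomogeneous_X ℂ (weight m q) 0).pow i).mul
    ((MvPolynomial.isWeightedHomogeneous_X ℂ (weight m q) 1).pow j) using 1
  ext <;> simp [weight, sub_eq_add_neg]

theorem isWeightedHomogeneous_isotypicPair (δ : Fin q → Fin q → Fin 2)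
    (t : Fin q × Fin q × Fin p) (i : Fin 2) :
    (isotypicPair δ t i).IsWeightedHomogeneous (weight (p * q) q) (isotypicWeight δ t) := by
  obtain ⟨a, b, c⟩ := t
  obtain ⟨l, hl⟩ := Nat.exists_eq_add_of_le (add_shift_le c (δ a b))
  have hl' : p - (c + δ a b : ℕ) = l := by omega
  have hm : (p * q : ZMod (p * q)) = 0 := (Nat.cast_mul p q).symm.trans (ZMod.natCast_self _)
  have hp : (p : ZMod (p * q)) = c + δ a b + l := by exact_mod_cast congrArg Nat.cast hl
  fin_cases i
  · convert isWeightedHomogeneous_varX_pow_mul_varY_pow (p * q) q (a + q * l) b using 1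
    · simp only [isotypicPair, Fin.zero_eta, Matrix.cons_val_zero, hl']
      ring
    · ext
      · simp [isotypicWeight]
      · push_cast [isotypicWeight]
        linear_combination q * hp - hm
  · convert isWeightedHomogeneous_varX_pow_mul_varY_pow (p * q) q a (b + q * (c + δ a b)) using 1
    · simp only [isotypicPair, Fin.mk_one, Matrix.cons_val_one, Matrix.cons_val_fin_one]
      ring
    · simp [isotypicWeight]

theorem isotypicWeight_injective (δ : Fin q → Fin q → Fin 2) :
    Function.Injective (isotypicWeight (p := p) δ) := by
  rintro ⟨a, b, c⟩ ⟨a', b', c'⟩ h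
  simp only [isotypicWeight, Prod.mk.injEq] at h
  obtain ⟨ha, hbc⟩ := h
  obtain rfl : a = a' :=
    Fin.ext (((ZMod.natCast_eq_natCast_iff _ _ _).1 ha).eq_of_lt_of_lt a.2 a'.2)
  replace hbc := (ZMod.natCast_eq_natCast_iff _ _ _).1 (sub_right_injective hbc)
  obtain rfl : b = b' := by
    have hb := hbc.of_dvd (Dvd.intro_left p rfl)
    rw [Nat.ModEq, Nat.add_mul_mod_self_left, Nat.add_mul_mod_self_left] at hb
    exact Fin.ext (Nat.ModEq.eq_of_lt_of_lt hb b.2 b'.2)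
  have hc := hbc.add_left_cancel'
  rw [mul_comm p, Nat.ModEq.mul_left_cancel_iff' (Fin.pos a).ne'] at hc
  obtain rfl : c = c' := Fin.ext (hc.add_right_cancel'.eq_of_lt_of_lt c.2 c'.2)
  rfl

theorem pow_varX_ne_pow_varY {k : ℕ} (hk : k ≠ 0) : (varX ^ k : S) ≠ varY ^ k := by
  intro h
  simpa [hk] using congrArg (MvPolynomial.eval ![1, 0]) h

instance (m p : ℕ) : FaithfulSMul (R m p) S :=
  (faithfulSMul_iff_algebraMap_injective _ _).2 (algebraMap_injective m p)

variable [NeZero p]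

theorem varX_pow_mul_varY_pow_mem_of_isotypicPair_mem {P : Submodule (R (p * q) p) S}
    {δ : Fin q → Fin q → Fin 2} (hP : ∀ (t : Fin q × Fin q × Fin p) i, isotypicPair δ t i ∈ P)
    (a b : Fin q) (k l : ℕ) :
    varX ^ (a : ℕ) * varY ^ (b : ℕ) * ((varX ^ q) ^ k * (varY ^ q) ^ l) ∈ P := by
  set d := δ a b with hd
  set w : S := varX ^ (a : ℕ) * varY ^ (b : ℕ)
  have hp := NeZero.pos p
  have hX (e : ℕ) (hde : d ≤ e) (he : e < p + d) : w * (varX ^ q) ^ (p - e) ∈ P := by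
    simpa [isotypicPair, ← hd, hde] using hP (a, b, ⟨e - d, by omega⟩) 0
  have hY (e : ℕ) (hde : d ≤ e) (he : e < p + d) : w * (varY ^ q) ^ e ∈ P := by
    simpa [isotypicPair, ← hd, hde] using hP (a, b, ⟨e - d, by omega⟩) 1
  have hw : w ∈ P := by
    rcases Nat.eq_zero_or_pos (d : ℕ) with h0 | h1
    · simpa using hY 0 (by omega) (by omega)
    · simpa using hX p (by omega) (by omega)
  refine mul_pow_mul_pow_mem (s₁ := σ₁ (p * q) p) (s₂ := σ₂ (p * q) p) (algebraMap_σ₁ p q)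
    (by rw [algebraMap_σ₂, mul_comm p, pow_mul, pow_mul]) hp (fun k hk => ?_)
    (fun k hk => ?_) ?_ k l
  · rcases Nat.eq_zero_or_pos k with rfl | hk0
    · simpa using hw
    · simpa [Nat.sub_sub_self hk.le] using hX (p - k) (by omega) (by omega)
  · rcases Nat.eq_zero_or_pos k with rfl | hk0
    · simpa using hw
    · exact hY k (by omega) (by omega)
  · rcases Nat.eq_zero_or_pos (d : ℕ) with h0 | h1
    · exact Or.inl (by simpa using hX 0 (by omega) (by omega))
    · exact Or.inr (hY p (by omega) (by omega))

variable [NeZero q]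

theorem linearIndependent_isotypicPair (δ : Fin q → Fin q → Fin 2) (t : Fin q × Fin q × Fin p) :
    LinearIndependent (R (p * q) p) (isotypicPair δ t) := by
  obtain ⟨a, b, c⟩ := t
  let τ : GL (Fin 2) ℂ := monomialGL (Equiv.swap 0 1) 1
  have hτ : τ ∈ G (p * q) p 2 := mem_G_iff.2 ⟨_, _, by simp, by simp, rfl⟩
  have hX : subst τ (varX ^ q) = varY ^ q := by simp [τ, subst_monomialGL_X]
  have hY : subst τ (varY ^ q) = varX ^ q := by simp [τ, subst_monomialGL_X]
  have hne : ((varX ^ q) ^ p : S) ≠ (varY ^ q) ^ p := by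
    rw [← pow_mul, ← pow_mul]
    exact pow_varX_ne_pow_varY (mul_ne_zero (NeZero.ne q) (NeZero.ne p))
  refine LinearIndependent.pair_iff.2 fun r s h => ?_
  refine eq_zero_of_smul_pow_add_smul_pow_eq_zero (subst_algebraMap hτ) hX hY hne
    (add_shift_le c (δ a b)) ?_
  rw [← mul_smul_comm, ← mul_smul_comm, ← mul_add] at h
  exact (mul_eq_zero.1 h).resolve_left (mul_ne_zero (pow_ne_zero _ (MvPolynomial.X_ne_zero _))
    (pow_ne_zero _ (MvPolynomial.X_ne_zero _)))

theorem span_isotypicPair (δ : Fin q → Fin q → Fin 2) :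
    Submodule.span (R (p * q) p)
      (Set.range fun t : (Fin q × Fin q × Fin p) × Fin 2 => isotypicPair δ t.1 t.2) = ⊤ := by
  set P := Submodule.span (R (p * q) p)
    (Set.range fun t : (Fin q × Fin q × Fin p) × Fin 2 => isotypicPair δ t.1 t.2)
  have hP (t : Fin q × Fin q × Fin p) (i : Fin 2) : isotypicPair δ t i ∈ P :=
    Submodule.subset_span ⟨(t, i), rfl⟩
  refine Submodule.eq_top_iff'.2 fun f => ?_
  induction f using MvPolynomial.induction_on' with
  | add f₁ f₂ h₁ h₂ => exact P.add_mem h₁ h₂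
  | monomial e c =>
    have h := P.smul_mem (algebraMap ℂ (R (p * q) p) c)
      (varX_pow_mul_varY_pow_mem_of_isotypicPair_mem hP (Fin.ofNat q (e 0)) (Fin.ofNat q (e 1))
        (e 0 / q) (e 1 / q))
    rw [Algebra.smul_def] at h
    convert h using 1
    rw [MvPolynomial.monomial_eq, Finsupp.prod_fintype _ _ (by simp), Fin.prod_univ_two]
    have hmod (x : S) (k : ℕ) : x ^ k = x ^ (k % q) * (x ^ q) ^ (k / q) := by
      rw [← pow_mul, ← pow_add, Nat.mod_add_div]
    rw [hmod _ (e 0), hmod _ (e 1), mul_mul_mul_comm]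
    rfl

/-- The basis of `S` over `R` formed by the pairs `isotypicPair δ t`. -/
def isotypicBasis (δ : Fin q → Fin q → Fin 2) :
    Module.Basis ((Fin q × Fin q × Fin p) × Fin 2) (R (p * q) p) S :=
  .mk (v := fun t => isotypicPair δ t.1 t.2)
    (linearIndependent_prod_of_isWeightedHomogeneous (isWeightedHomogeneous_algebraMap p q)
      (isotypicWeight_injective δ) (isWeightedHomogeneous_isotypicPair δ)
      (linearIndependent_isotypicPair δ))
    (span_isotypicPair δ).ge

theorem isotypicBasis_apply (δ : Fin q → Fin q → Fin 2) (t : (Fin q × Fin q × Fin p) × Fin 2) :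
    isotypicBasis δ t = isotypicPair δ t.1 t.2 := by
  simp [isotypicBasis]

end Basis

section Cokernels

variable {A : Type*} [CommRing A]

theorem range_piMap {ι : Type*} {M N : ι → Type*} [∀ i, AddCommGroup (M i)] [∀ i, Module A (M i)]
    [∀ i, AddCommGroup (N i)] [∀ i, Module A (N i)] (f : ∀ i, M i →ₗ[A] N i) :
    LinearMap.range (LinearMap.piMap f) =
      Submodule.pi Set.univ fun i => LinearMap.range (f i) := by
  refine SetLike.coe_injective ?_
  rw [LinearMap.coe_range, LinearMap.coe_piMap, Set.range_piMap]
  rfl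

theorem nonempty_coker_linearEquiv_of_mul_eq {n : ℕ} {M M' P Q : Matrix (Fin n) (Fin n) A}
    (hP : IsUnit P.det) (hQ : IsUnit Q.det) (h : P * M = M' * Q) :
    Nonempty (Coker M ≃ₗ[A] Coker M') := by
  let e := Matrix.toLinearEquiv (Pi.basisFun A (Fin n)) P hP
  let f := Matrix.toLinearEquiv (Pi.basisFun A (Fin n)) Q hQ
  have he : e.toLinearMap = P.mulVecLin := congr($Matrix.toLin_eq_toLin' P)
  have hf : f.toLinearMap = Q.mulVecLin := congr($Matrix.toLin_eq_toLin' Q)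
  refine ⟨Submodule.Quotient.equiv _ _ e ?_⟩
  rw [he, ← LinearMap.range_comp, ← Matrix.mulVecLin_mul, h, Matrix.mulVecLin_mul, ← hf,
    LinearMap.range_comp_of_range_eq_top _ f.range]

theorem nonempty_coker_diagonal_linearEquiv {n : ℕ} (d : Fin n → A) :
    Nonempty (Coker (Matrix.diagonal d) ≃ₗ[A] ∀ i, A ⧸ Ideal.span {d i}) := by
  have h : (Matrix.diagonal d).mulVecLin =
      LinearMap.piMap fun i => LinearMap.toSpanSingleton A A (d i) := by
    refine LinearMap.ext fun v => funext fun i => ?_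
    simp [Matrix.mulVec_diagonal, mul_comm]
  refine ⟨Submodule.quotEquivOfEq _ _ ?_ ≪≫ₗ Submodule.quotientPi fun i => Ideal.span {d i}⟩
  rw [h, range_piMap]
  simp only [LinearMap.range_toSpanSingleton]

theorem nonempty_coker_linearEquiv_prod_of_isUnit {u : A} (hu : IsUnit u) (s a b v : A) :
    Nonempty (Coker (s • !![a, u; v, b]) ≃ₗ[A]
      (A ⧸ Ideal.span {s}) × (A ⧸ Ideal.span {s * (a * b - u * v)})) := by
  obtain ⟨e⟩ := nonempty_coker_linearEquiv_of_mul_eq (M := s • !![a, u; v, b])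
    (M' := Matrix.diagonal ![s, s * (a * b - u * v)]) (P := !![1, 0; b, -u]) (Q := !![a, u; 1, 0])
    (by simpa using hu) (by simpa using hu) <| by
      ext i j
      fin_cases i <;> fin_cases j <;> simp [Matrix.mul_apply, Fin.sum_univ_two] <;> ring
  obtain ⟨f⟩ := nonempty_coker_diagonal_linearEquiv ![s, s * (a * b - u * v)]
  exact ⟨e ≪≫ₗ f ≪≫ₗ LinearEquiv.piFinTwo A _⟩

theorem nonempty_quotient_range_linearEquiv_pi_coker {M N ι : Type*} [AddCommGroup M] [Module A M]
    [AddCommGroup N] [Module A N] [Finite ι] {n : ℕ} {g : M →ₗ[A] N} {e : ι × Fin n → M}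
    (he : Submodule.span A (Set.range e) = ⊤) (f : Module.Basis (ι × Fin n) A N)
    {T : ι → Matrix (Fin n) (Fin n) A}
    (h : ∀ t k, g (e (t, k)) = ∑ l, T t l k • f (t, l)) :
    Nonempty ((N ⧸ LinearMap.range g) ≃ₗ[A] ∀ t, Coker (T t)) := by
  classical
  have := Fintype.ofFinite ι
  let F : N ≃ₗ[A] ι → Fin n → A := f.equivFun ≪≫ₗ LinearEquiv.curry A A ι (Fin n)
  let E : (ι → Fin n → A) →ₗ[A] M :=
    Fintype.linearCombination A e ∘ₗ (LinearEquiv.curry A A ι (Fin n)).symm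
  have hE : LinearMap.range E = ⊤ := by
    rw [LinearMap.range_comp_of_range_eq_top _ (LinearEquiv.range _),
      Fintype.range_linearCombination, he]
  have hE_single (t : ι) (k : Fin n) : E (Pi.single t (Pi.single k 1)) = e (t, k) := by
    simp [E]
  have hFE : F ∘ₗ g ∘ₗ E = LinearMap.piMap fun t => (T t).mulVecLin := by
    ext t k t' l
    rcases eq_or_ne t' t with rfl | ht
    · simp [hE_single, h, F, Finsupp.single_apply]
    · simp [hE_single, h, F, ht]
  have hmap : (LinearMap.range g).map (F : N →ₗ[A] ι → Fin n → A) =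
      Submodule.pi Set.univ fun t => LinearMap.range (T t).mulVecLin := by
    rw [← range_piMap, ← hFE, ← LinearMap.comp_assoc, LinearMap.range_comp_of_range_eq_top _ hE,
      LinearMap.range_comp]
  exact ⟨Submodule.Quotient.equiv _ _ F hmap ≪≫ₗ Submodule.quotientPi _⟩

theorem nonempty_quotient_span_singleton_linearEquiv_pi_coker {B ι : Type*} [CommRing B]
    [Algebra A B] [Finite ι] {n : ℕ} {z : B} {e : ι × Fin n → B}
    (he : Submodule.span A (Set.range e) = ⊤) (f : Module.Basis (ι × Fin n) A B)
    {T : ι → Matrix (Fin n) (Fin n) A}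
    (h : ∀ t k, z * e (t, k) = ∑ l, T t l k • f (t, l)) :
    Nonempty ((B ⧸ Ideal.span {z}) ≃ₗ[A] ∀ t, Coker (T t)) := by
  obtain ⟨k⟩ := nonempty_quotient_range_linearEquiv_pi_coker (g := LinearMap.mulLeft A z) he f h
  have hz : (Ideal.span {z}).restrictScalars A = LinearMap.range (LinearMap.mulLeft A z) := by
    ext b
    simp [Ideal.mem_span_singleton', mul_comm]
  exact ⟨(Submodule.Quotient.restrictScalarsEquiv A (Ideal.span {z})).symm ≪≫ₗ
    Submodule.quotEquivOfEq _ _ hz ≪≫ₗ k⟩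

end Cokernels

/-! ### Multiplication by `xy(x^m - y^m)` -/

section Blocks

theorem pow_mul_pow_mul_pow_sub_pow_mul_pow {B : Type*} [CommRing B] (u v : B)
    {p α β e e' : ℕ} (he : e ≤ p) (he' : e' ≤ p) (h : e' + α = e + β) :
    u ^ α * v ^ β * (u ^ p - v ^ p) * u ^ (p - e) =
        (u * v) ^ β * (u ^ p + v ^ p) * u ^ (p - e') -
          2 * (u * v) ^ (α + (p - e)) * v ^ e' ∧
      u ^ α * v ^ β * (u ^ p - v ^ p) * v ^ e =
        2 * (u * v) ^ (β + e) * u ^ (p - e') - (u * v) ^ α * (u ^ p + v ^ p) * v ^ e' := by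
  obtain ⟨k, rfl⟩ := Nat.exists_eq_add_of_le he
  obtain ⟨k', hk'⟩ := Nat.exists_eq_add_of_le he'
  have hu : u ^ k' * u ^ β = u ^ k * u ^ α := by rw [← pow_add, ← pow_add]; congr 1; omega
  have hv : v ^ e' * v ^ α = v ^ e * v ^ β := by rw [← pow_add, ← pow_add, h]
  rw [show e + k - e' = k' by omega, Nat.add_sub_cancel_left]
  constructor
  · linear_combination (-v ^ β * (u ^ (e + k) + v ^ (e + k))) * hu +
      2 * u ^ (α + k) * v ^ k * hv
  · linear_combination (-2 * u ^ e * v ^ (β + e)) * hu + u ^ α * (u ^ (e + k) + v ^ (e + k)) * hv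

variable {n : ℕ}

/-- The number of times that adding `1` to `a - 1` in `Fin (n + 1)` exceeds `n`. -/
def carry (a : Fin (n + 1)) : ℕ :=
  if a = 0 then 1 else 0

theorem mul_pow_coe_sub_one {B : Type*} [CommRing B] (x : B) (a : Fin (n + 1)) :
    x * x ^ ((a - 1 : Fin (n + 1)) : ℕ) = x ^ (a : ℕ) * (x ^ (n + 1)) ^ carry a := by
  rcases eq_or_ne a 0 with rfl | ha
  · simp [carry, pow_succ']
  · have : (a : ℕ) ≠ 0 := Fin.val_ne_zero_iff.2 ha
    simp [Fin.coe_sub_one, carry, ha, mul_pow_sub_one this]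

/-- The shift of the basis in the source of the multiplication by `xy(x^m - y^m)`. -/
def sourceShift (a b : Fin (n + 1)) : Fin 2 :=
  if a + 1 = 0 ∧ b + 1 ≠ 0 then 1 else 0

/-- The shift of the basis in the target of the multiplication by `xy(x^m - y^m)`. -/
def targetShift (a b : Fin (n + 1)) : Fin 2 :=
  if a ≠ 0 ∧ b = 0 then 1 else 0

theorem targetShift_add_carry (a b : Fin (n + 1)) :
    (targetShift a b : ℕ) + carry a = sourceShift (a - 1) (b - 1) + carry b := by
  by_cases ha : a = 0 <;> by_cases hb : b = 0 <;> simp [targetShift, sourceShift, carry, ha, hb]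

variable {p : ℕ}

/-- The block of the multiplication by `xy(x^m - y^m)` from the isotypic component of
`x^{a-1} y^{b-1}` to that of `x^a y^b`, where `a - 1` and `b - 1` are taken modulo `q = n + 1`. -/
def mulBlock (t : Fin (n + 1) × Fin (n + 1) × Fin p) :
    Matrix (Fin 2) (Fin 2) (R (p * (n + 1)) p) :=
  let e : ℕ := t.2.2 + sourceShift (t.1 - 1) (t.2.1 - 1)
  !![σ₁ _ p ^ carry t.2.1 * σ₂ _ p, 2 * σ₁ _ p ^ (carry t.2.1 + e);
    -2 * σ₁ _ p ^ (carry t.1 + (p - e)), -σ₁ _ p ^ carry t.1 * σ₂ _ p]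

variable [NeZero p]

theorem mul_isotypicPair (t : Fin (n + 1) × Fin (n + 1) × Fin p) (k : Fin 2) :
    varX * varY * (varX ^ (p * (n + 1)) - varY ^ (p * (n + 1))) *
        isotypicPair sourceShift (t.1 - 1, t.2.1 - 1, t.2.2) k =
      ∑ l, mulBlock t l k • isotypicPair targetShift t l := by
  obtain ⟨a, b, c⟩ := t
  set w : S := varX ^ (a : ℕ) * varY ^ (b : ℕ)
  set w' : S := varX ^ ((a - 1 : Fin (n + 1)) : ℕ) * varY ^ ((b - 1 : Fin (n + 1)) : ℕ)
  set e : ℕ := c + sourceShift (a - 1) (b - 1)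
  have hw : varX * varY * (varX ^ (p * (n + 1)) - varY ^ (p * (n + 1))) * w' =
      w * ((varX ^ (n + 1)) ^ carry a * (varY ^ (n + 1)) ^ carry b *
        ((varX ^ (n + 1)) ^ p - (varY ^ (n + 1)) ^ p)) := by
    rw [mul_right_comm, mul_mul_mul_comm, mul_pow_coe_sub_one, mul_pow_coe_sub_one]
    ring
  obtain ⟨h₀, h₁⟩ := pow_mul_pow_mul_pow_sub_pow_mul_pow (varX ^ (n + 1) : S) (varY ^ (n + 1))
    (add_shift_le c (sourceShift (a - 1) (b - 1))) (add_shift_le c (targetShift a b))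
    (by rw [add_assoc, targetShift_add_carry, ← add_assoc])
  have h2 : algebraMap (R (p * (n + 1)) p) S 2 = 2 := map_ofNat _ 2
  simp only [Fin.sum_univ_two, Algebra.smul_def]
  fin_cases k <;>
    simp only [mulBlock, isotypicPair, Fin.zero_eta, Fin.mk_one, Matrix.of_apply, Matrix.cons_val',
      Matrix.cons_val_zero, Matrix.cons_val_one, Matrix.cons_val_fin_one, map_mul, map_pow,
      map_neg, h2, algebraMap_σ₁, algebraMap_σ₂]
  · linear_combination (varX ^ (n + 1)) ^ (p - e) * hw + w * h₀
  · linear_combination (varY ^ (n + 1)) ^ e * hw + w * h₁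

theorem nonempty_quotient_linearEquiv_pi_coker_mulBlock (p n : ℕ) [NeZero p] :
    Nonempty ((S ⧸ Ideal.span {varX * varY * (varX ^ (p * (n + 1)) - varY ^ (p * (n + 1)))})
      ≃ₗ[R (p * (n + 1)) p] ∀ t : Fin (n + 1) × Fin (n + 1) × Fin p, Coker (mulBlock t)) := by
  let shift := Equiv.prodCongr (.prodCongr (.subRight (1 : Fin (n + 1)))
    (.prodCongr (.subRight (1 : Fin (n + 1))) (.refl (Fin p)))) (.refl (Fin 2))
  have hspan := span_isotypicPair (p := p) (q := n + 1) sourceShift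
  rw [← shift.surjective.range_comp] at hspan
  refine nonempty_quotient_span_singleton_linearEquiv_pi_coker hspan (isotypicBasis targetShift)
    fun t k => ?_
  simp only [isotypicBasis_apply]
  exact mul_isotypicPair t k

end Blocks

section MatrixFactorizations

theorem isUnit_two (m p : ℕ) : IsUnit (2 : R m p) := by
  have h : IsUnit (algebraMap ℂ (R m p) 2) := (IsUnit.mk0 (2 : ℂ) two_ne_zero).map _
  rwa [map_ofNat] at h

theorem nonempty_K_sub_linearEquiv (m : ℕ) {p j : ℕ} (hj : j ≤ p) :
    Nonempty (K m p (p - j) ≃ₗ[R m p] K m p j) :=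
  nonempty_coker_linearEquiv_of_mul_eq (P := !![0, 1; 1, 0]) (Q := !![0, 1; 1, 0])
    (by simp) (by simp) (by simp [φ, Nat.sub_sub_self hj])

theorem nonempty_N_sub_linearEquiv (m : ℕ) {p j : ℕ} (hj : j ≤ p) :
    Nonempty (N m p (p - j) ≃ₗ[R m p] N m p j) := by
  have hj' : p + 1 - (p - j) = j + 1 := by omega
  exact nonempty_coker_linearEquiv_of_mul_eq (P := !![0, 1; 1, 0]) (Q := !![0, 1; 1, 0])
    (by simp) (by simp) (by simp [ψ, hj', Nat.sub_add_comm hj])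

theorem nonempty_K_zero_linearEquiv (m p : ℕ) :
    Nonempty (K m p 0 ≃ₗ[R m p] R m p ⧸ Ideal.span {σ₂ m p ^ 2 - 4 * σ₁ m p ^ p}) := by
  obtain ⟨e⟩ := nonempty_coker_linearEquiv_prod_of_isUnit (isUnit_two m p) 1 (σ₂ m p) (σ₂ m p)
    (2 * σ₁ m p ^ p)
  have hφ : φ m p 0 = (1 : R m p) • !![σ₂ m p, 2; 2 * σ₁ m p ^ p, σ₂ m p] := by simp [φ]
  have hdet : σ₂ m p ^ 2 - 4 * σ₁ m p ^ p =
      1 * (σ₂ m p * σ₂ m p - 2 * (2 * σ₁ m p ^ p)) := by ring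
  have : Subsingleton (R m p ⧸ Ideal.span {(1 : R m p)}) :=
    Ideal.Quotient.subsingleton_iff.2 Ideal.span_singleton_one
  have : Unique (R m p ⧸ Ideal.span {(1 : R m p)}) := .mk' _
  unfold K
  rw [hφ, hdet]
  exact ⟨e ≪≫ₗ LinearEquiv.uniqueProd⟩

theorem nonempty_N_zero_linearEquiv (m p : ℕ) :
    Nonempty (N m p 0 ≃ₗ[R m p]
      (R m p ⧸ Ideal.span {σ₁ m p}) × (R m p ⧸ Ideal.span {Δ m p})) := by
  obtain ⟨e⟩ := nonempty_coker_linearEquiv_prod_of_isUnit (isUnit_two m p).neg (σ₁ m p) (σ₂ m p)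
    (σ₂ m p) (-2 * σ₁ m p ^ p)
  have hψ : ψ m p 0 = σ₁ m p • !![σ₂ m p, -2; -2 * σ₁ m p ^ p, σ₂ m p] := by
    simp [ψ, pow_succ', mul_comm, mul_left_comm]
  have hΔ : Δ m p = σ₁ m p * (σ₂ m p * σ₂ m p - -2 * (-2 * σ₁ m p ^ p)) := by rw [Δ]; ring
  unfold N
  rw [hψ, hΔ]
  exact ⟨e⟩

variable {p n : ℕ}

theorem nonempty_coker_mulBlock_zero_zero_linearEquiv (n : ℕ) (c : Fin p) :
    Nonempty
      (Coker (mulBlock ((0 : Fin (n + 1)), 0, c)) ≃ₗ[R (p * (n + 1)) p] N (p * (n + 1)) p c) := by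
  have hc : 1 + (p - (c : ℕ)) = p + 1 - c := by omega
  exact nonempty_coker_linearEquiv_of_mul_eq (P := 1) (Q := !![1, 0; 0, -1]) (by simp) (by simp)
    (by simp [mulBlock, sourceShift, carry, ψ, hc, mul_comm, add_comm])

theorem nonempty_coker_mulBlock_zero_succ_linearEquiv (b : Fin n) (c : Fin p) :
    Nonempty (Coker (mulBlock (0, b.succ, c)) ≃ₗ[R (p * (n + 1)) p] X (p * (n + 1)) p (c + 1)) := by
  have hc : 1 + (p - (c + 1 : ℕ)) = p + 1 - (c + 1) := by omega
  exact nonempty_coker_linearEquiv_of_mul_eq (P := !![1, 0; 0, -1]) (Q := 1) (by simp) (by simp)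
    (by simp [mulBlock, sourceShift, carry, ξ, hc, mul_comm, Fin.succ_ne_zero])

theorem nonempty_coker_mulBlock_succ_zero_linearEquiv (a : Fin n) (c : Fin p) :
    Nonempty (Coker (mulBlock (a.succ, 0, c)) ≃ₗ[R (p * (n + 1)) p] X (p * (n + 1)) p (p - c)) := by
  have hc : p + 1 - (p - c : ℕ) = c + 1 := by omega
  exact nonempty_coker_linearEquiv_of_mul_eq (P := !![0, -1; 1, 0]) (Q := !![0, 1; 1, 0])
    (by simp) (by simp)
    (by simp [mulBlock, sourceShift, carry, ξ, hc, mul_comm, add_comm, Fin.succ_ne_zero])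

theorem nonempty_coker_mulBlock_succ_succ_linearEquiv (a b : Fin n) (c : Fin p) :
    Nonempty (Coker (mulBlock (a.succ, b.succ, c)) ≃ₗ[R (p * (n + 1)) p] K (p * (n + 1)) p c) :=
  nonempty_coker_linearEquiv_of_mul_eq (P := !![1, 0; 0, -1]) (Q := 1) (by simp) (by simp)
    (by simp [mulBlock, sourceShift, carry, φ, Fin.succ_ne_zero])

end MatrixFactorizations

/-! ### Products of modules -/

section Products

variable {A : Type*} [CommRing A]

/-- Separation of the zero indices in a product over `Fin (n + 1) × Fin (n + 1) × ι`. -/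
def piFinSuccFinSucc {n : ℕ} {ι : Type*} (M : Fin (n + 1) × Fin (n + 1) × ι → Type*)
    [∀ t, AddCommGroup (M t)] [∀ t, Module A (M t)] :
    (∀ t, M t) ≃ₗ[A] (∀ t : Unit × ι, M (0, 0, t.2)) ×
      ((∀ t : Fin n × ι, M (0, t.1.succ, t.2)) × (∀ t : Fin n × ι, M (t.1.succ, 0, t.2))) ×
      (∀ t : (Fin n × Fin n) × ι, M (t.1.1.succ, t.1.2.succ, t.2)) where
  toFun f := (fun t => f (0, 0, t.2),
    (fun t => f (0, t.1.succ, t.2), fun t => f (t.1.succ, 0, t.2)),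
    fun t => f (t.1.1.succ, t.1.2.succ, t.2))
  invFun g t := Fin.cases (motive := fun a => ∀ b c, M (a, b, c))
    (Fin.cases (fun c => g.1 ((), c)) fun b c => g.2.1.1 (b, c))
    (fun a => Fin.cases (fun c => g.2.1.2 (a, c)) fun b c => g.2.2 ((a, b), c)) t.1 t.2.1 t.2.2
  map_add' _ _ := rfl
  map_smul' _ _ := rfl
  left_inv f := by
    ext ⟨a, b, c⟩
    induction a using Fin.cases <;> induction b using Fin.cases <;> rfl
  right_inv _ := rfl

/-- Separation of the summands of the second index in a product over `τ × (ι ⊕ κ)`. -/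
def piProdSum {τ ι κ : Type*} (M : τ × (ι ⊕ κ) → Type*) [∀ t, AddCommGroup (M t)]
    [∀ t, Module A (M t)] :
    (∀ t, M t) ≃ₗ[A] (∀ t : τ × ι, M (t.1, .inl t.2)) × ∀ t : τ × κ, M (t.1, .inr t.2) :=
  (LinearEquiv.piCongrLeft A M (Equiv.prodSumDistrib τ ι κ).symm).symm ≪≫ₗ
    LinearEquiv.sumPiEquivProdPi A _ _ _

/-- Two products over `τ × κ` whose factors depend only on the second index, as a product over
`κ` of powers. -/
def piProdPiEquivPiFun {τ κ : Type*} (F : κ → Type*) [∀ k, AddCommGroup (F k)]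
    [∀ k, Module A (F k)] :
    ((∀ t : τ × κ, F t.2) × (∀ t : τ × κ, F t.2)) ≃ₗ[A] ∀ k, τ ⊕ τ → F k where
  toFun f k := Sum.elim (fun t => f.1 (t, k)) fun t => f.2 (t, k)
  invFun g := (fun t => g t.2 (.inl t.1), fun t => g t.2 (.inr t.1))
  map_add' _ _ := by
    ext k (t | t) <;> rfl
  map_smul' _ _ := by
    ext k (t | t) <;> rfl
  left_inv _ := rfl
  right_inv _ := by
    ext k (t | t) <;> rfl

theorem nonempty_pi_prod_pi_linearEquiv_directSum {τ ι κ : Type*} [Fintype τ] [Finite κ]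
    {M₁ M₂ : τ × ι → Type*} [∀ t, AddCommGroup (M₁ t)] [∀ t, Module A (M₁ t)]
    [∀ t, AddCommGroup (M₂ t)] [∀ t, Module A (M₂ t)]
    {F : κ → Type*} [∀ k, AddCommGroup (F k)] [∀ k, Module A (F k)] (e₁ e₂ : ι ≃ κ)
    (h₁ : ∀ t i, Nonempty (M₁ (t, i) ≃ₗ[A] F (e₁ i)))
    (h₂ : ∀ t i, Nonempty (M₂ (t, i) ≃ₗ[A] F (e₂ i))) {a : ℕ} (ha : Fintype.card τ = a) :
    Nonempty (((∀ t, M₁ t) × (∀ t, M₂ t)) ≃ₗ[A] ⨁ k, (Fin (2 * a) → F k)) := by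
  classical
  have := Fintype.ofFinite κ
  have reindex (e : ι ≃ κ) : (∀ t : τ × ι, F (e t.2)) ≃ₗ[A] ∀ t : τ × κ, F t.2 :=
    LinearEquiv.piCongrLeft A (fun t : τ × κ => F t.2) (.prodCongr (.refl τ) e)
  have hcard : Fintype.card (τ ⊕ τ) = 2 * a := by rw [Fintype.card_sum, ha, two_mul]
  exact ⟨((LinearEquiv.piCongrRight fun t => (h₁ t.1 t.2).some) ≪≫ₗ reindex e₁).prodCongr
    ((LinearEquiv.piCongrRight fun t => (h₂ t.1 t.2).some) ≪≫ₗ reindex e₂) ≪≫ₗ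
    piProdPiEquivPiFun F ≪≫ₗ
    (LinearEquiv.piCongrRight fun _ =>
      LinearEquiv.funCongrLeft A _ (Fintype.equivFinOfCardEq hcard).symm) ≪≫ₗ
    (DirectSum.linearEquivFunOnFintype A κ fun k => Fin (2 * a) → F k).symm⟩

/-- The bijection `c ↦ c + 1`. -/
def finEquivIccSucc (p : ℕ) : Fin p ≃ Finset.Icc 1 p where
  toFun c := ⟨c + 1, Finset.mem_Icc.2 (by omega)⟩
  invFun j := ⟨j - 1, by have := Finset.mem_Icc.1 j.2; omega⟩
  left_inv c := by simp
  right_inv j := by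
    have := Finset.mem_Icc.1 j.2
    ext
    simp only
    omega

/-- The bijection `c ↦ p - c`. -/
def finEquivIccSub (p : ℕ) : Fin p ≃ Finset.Icc 1 p where
  toFun c := ⟨p - c, Finset.mem_Icc.2 (by omega)⟩
  invFun j := ⟨p - j, by have := Finset.mem_Icc.1 j.2; omega⟩
  left_inv c := Fin.ext (Nat.sub_sub_self c.2.le)
  right_inv j := Subtype.ext (Nat.sub_sub_self (Finset.mem_Icc.1 j.2).2)

/-- The indices `0`, `j` and `p - j` with `1 ≤ j ≤ (p - 1)/2`, where `p` is odd. -/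
def unitSumIccSumIccEquivFin {p : ℕ} (hp : Odd p) :
    Unit ⊕ (Finset.Icc 1 ((p - 1) / 2) ⊕ Finset.Icc 1 ((p - 1) / 2)) ≃ Fin p :=
  .ofBijective
    (Sum.elim (fun _ => ⟨0, hp.pos⟩) <| Sum.elim
      (fun j => ⟨j, by have := Finset.mem_Icc.1 j.2; omega⟩)
      (fun j => ⟨p - j, by have := Finset.mem_Icc.1 j.2; omega⟩)) <| by
    obtain ⟨k, rfl⟩ := hp
    refine (Fintype.bijective_iff_surjective_and_card _).2 ⟨fun c => ?_, ?_⟩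
    · rcases Nat.eq_zero_or_pos (c : ℕ) with h₀ | h₀
      · exact ⟨.inl (), Fin.ext h₀.symm⟩
      rcases le_or_gt (c : ℕ) k with h | h
      · exact ⟨.inr (.inl ⟨c, Finset.mem_Icc.2 (by omega)⟩), rfl⟩
      · exact ⟨.inr (.inr ⟨2 * k + 1 - c, Finset.mem_Icc.2 (by omega)⟩),
          Fin.ext (Nat.sub_sub_self c.2.le)⟩
    · simp only [Fintype.card_sum, Fintype.card_unit, Fintype.card_coe, Nat.card_Icc,
        Fintype.card_fin]
      omega

theorem nonempty_pi_linearEquiv_prod_directSum_of_symm {τ : Type*} [Fintype τ] {p : ℕ} (hp : Odd p)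
    {M : τ × Fin p → Type*} [∀ t, AddCommGroup (M t)] [∀ t, Module A (M t)]
    {F : ℕ → Type*} [∀ j, AddCommGroup (F j)] [∀ j, Module A (F j)]
    (hM : ∀ t c, Nonempty (M (t, c) ≃ₗ[A] F c))
    (hF : ∀ j ≤ p, Nonempty (F (p - j) ≃ₗ[A] F j)) {a : ℕ} (ha : Fintype.card τ = a) :
    Nonempty ((∀ t, M t) ≃ₗ[A]
      (Fin a → F 0) × ⨁ j : Finset.Icc 1 ((p - 1) / 2), (Fin (2 * a) → F j)) := by
  let e := unitSumIccSumIccEquivFin hp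
  obtain ⟨f⟩ := nonempty_pi_prod_pi_linearEquiv_directSum (A := A) (τ := τ)
    (M₁ := fun t => F (e (.inr (.inl t.2)))) (M₂ := fun t => F (e (.inr (.inr t.2))))
    (F := fun j : Finset.Icc 1 ((p - 1) / 2) => F j) (.refl _) (.refl _)
    (fun _ _ => ⟨.refl A _⟩) (fun _ j => hF j (by have := Finset.mem_Icc.1 j.2; omega)) ha
  exact ⟨(LinearEquiv.piCongrRight fun t => (hM t.1 t.2).some) ≪≫ₗ
    (LinearEquiv.piCongrLeft A (fun t : τ × Fin p => F t.2) (.prodCongr (.refl τ) e)).symm ≪≫ₗ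
    piProdSum _ ≪≫ₗ (LinearEquiv.funCongrLeft A (F 0) ((Fintype.equivFinOfCardEq ha).symm.trans
      (Equiv.prodPUnit τ).symm)).prodCongr (piProdSum _ ≪≫ₗ f)⟩

end Products

section Rearrangement

variable {A : Type*} [CommRing A] {M M₁ M₂ M₃ M₄ M₅ M₆ M₇ : Type*}
  [AddCommMonoid M] [AddCommMonoid M₁] [AddCommMonoid M₂] [AddCommMonoid M₃] [AddCommMonoid M₄]
  [AddCommMonoid M₅] [AddCommMonoid M₆] [AddCommMonoid M₇] [Module A M] [Module A M₁]
  [Module A M₂] [Module A M₃] [Module A M₄] [Module A M₅] [Module A M₆] [Module A M₇]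

/-- Concatenation of a `k`-tuple and an `n`-tuple. -/
def finFunProdEquiv (A M : Type*) [CommRing A] [AddCommMonoid M] [Module A M] (k n : ℕ) :
    ((Fin k → M) × (Fin n → M)) ≃ₗ[A] (Fin (k + n) → M) :=
  (LinearEquiv.sumArrowLequivProdArrow (Fin k) (Fin n) A M).symm ≪≫ₗ
    LinearEquiv.funCongrLeft A M finSumFinEquiv.symm

variable (A M₁ M₂ M₃ M₄ M₅ M₆ M₇) in
/-- The permutation that brings the factors to the order of the indices. -/
def prodSortEquiv : (((M₅ × M₇) × M₂) × M₁ × M₄ × M₆ × M₃) ≃ₗ[A]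
    M₁ × M₂ × M₃ × M₄ × M₅ × M₆ × M₇ where
  toFun v := (v.2.1, v.1.2, v.2.2.2.2, v.2.2.1, v.1.1.1, v.2.2.2.1, v.1.1.2)
  invFun w :=
    (((w.2.2.2.2.1, w.2.2.2.2.2.2), w.2.1), w.1, w.2.2.2.1, w.2.2.2.2.2.1, w.2.2.1)
  map_add' _ _ := rfl
  map_smul' _ _ := rfl
  left_inv _ := rfl
  right_inv _ := rfl

variable (M₁ M₂ M₃ M₅ M₇) in
/-- Amalgamation of the fourth and the sixth factor along an isomorphism. -/
def prodMergeEquiv (f : (M₆ × M₄) ≃ₗ[A] M) :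
    (M₁ × M₂ × M₃ × M₄ × M₅ × M₆ × M₇) ≃ₗ[A] M₁ × M₂ × M₃ × M₅ × M × M₇ :=
  let e : (M₄ × M₅ × M₆ × M₇) ≃ₗ[A] M₅ × (M₆ × M₄) × M₇ :=
    { toFun v := (v.2.1, (v.2.2.1, v.1), v.2.2.2)
      invFun w := (w.2.1.2, w.1, w.2.1.1, w.2.2)
      map_add' _ _ := rfl
      map_smul' _ _ := rfl
      left_inv _ := rfl
      right_inv _ := rfl }
  (LinearEquiv.refl A M₁).prodCongr <| (LinearEquiv.refl A M₂).prodCongr <|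
    (LinearEquiv.refl A M₃).prodCongr <|
    e ≪≫ₗ (LinearEquiv.refl A M₅).prodCongr (f.prodCongr (.refl A M₇))

end Rearrangement

section Decomposition

variable {p : ℕ}

theorem sq_eq_two_mul_choose_two_add (n : ℕ) : n ^ 2 = 2 * n.choose 2 + n := by
  rw [Nat.choose_two_right, Nat.mul_div_cancel' (Nat.even_mul_pred_self n).two_dvd, sq,
    ← Nat.mul_add_one]
  cases n <;> simp

theorem nonempty_pi_coker_mulBlock_zero_zero_linearEquiv (n : ℕ) (hp : Odd p) :
    Nonempty ((∀ t : Unit × Fin p, Coker (mulBlock ((0 : Fin (n + 1)), 0, t.2)))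
      ≃ₗ[R (p * (n + 1)) p]
        ((R (p * (n + 1)) p ⧸ Ideal.span {σ₁ (p * (n + 1)) p}) ×
          (R (p * (n + 1)) p ⧸ Ideal.span {Δ (p * (n + 1)) p})) ×
        ⨁ j : Finset.Icc 1 ((p - 1) / 2), (Fin 2 → N (p * (n + 1)) p j)) := by
  obtain ⟨e⟩ := nonempty_pi_linearEquiv_prod_directSum_of_symm (τ := Unit) hp
    (M := fun t : Unit × Fin p => Coker (mulBlock ((0 : Fin (n + 1)), 0, t.2)))
    (F := N (p * (n + 1)) p) (fun _ => nonempty_coker_mulBlock_zero_zero_linearEquiv n)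
    (fun _ => nonempty_N_sub_linearEquiv _) Fintype.card_unit
  obtain ⟨f⟩ := nonempty_N_zero_linearEquiv (p * (n + 1)) p
  let u := LinearEquiv.funUnique (Fin 1) (R (p * (n + 1)) p) (N (p * (n + 1)) p 0)
  exact ⟨e ≪≫ₗ (u ≪≫ₗ f).prodCongr (.refl _ _)⟩

theorem nonempty_pi_coker_mulBlock_prod_linearEquiv (p n : ℕ) :
    Nonempty (((∀ t : Fin n × Fin p, Coker (mulBlock ((0 : Fin (n + 1)), t.1.succ, t.2))) ×
        (∀ t : Fin n × Fin p, Coker (mulBlock (t.1.succ, (0 : Fin (n + 1)), t.2))))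
      ≃ₗ[R (p * (n + 1)) p] ⨁ j : Finset.Icc 1 p, (Fin (2 * n) → X (p * (n + 1)) p j)) :=
  nonempty_pi_prod_pi_linearEquiv_directSum (τ := Fin n)
    (M₁ := fun t : Fin n × Fin p => Coker (mulBlock ((0 : Fin (n + 1)), t.1.succ, t.2)))
    (M₂ := fun t : Fin n × Fin p => Coker (mulBlock (t.1.succ, (0 : Fin (n + 1)), t.2)))
    (F := fun j : Finset.Icc 1 p => X (p * (n + 1)) p j) (finEquivIccSucc p) (finEquivIccSub p)
    nonempty_coker_mulBlock_zero_succ_linearEquiv nonempty_coker_mulBlock_succ_zero_linearEquiv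
    (Fintype.card_fin n)

set_option synthInstance.maxHeartbeats 40000 in
-- the module structure on the product of the three families is slow to find
theorem nonempty_pi_coker_mulBlock_succ_succ_linearEquiv (n : ℕ) (hp : Odd p) :
    Nonempty ((∀ t : (Fin n × Fin n) × Fin p, Coker (mulBlock (t.1.1.succ, t.1.2.succ, t.2)))
      ≃ₗ[R (p * (n + 1)) p]
        (Fin (2 * n.choose 2) → K (p * (n + 1)) p 0) ×
        (Fin n → R (p * (n + 1)) p ⧸
          Ideal.span {σ₂ (p * (n + 1)) p ^ 2 - 4 * σ₁ (p * (n + 1)) p ^ p}) ×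
        ⨁ j : Finset.Icc 1 ((p - 1) / 2), (Fin (2 * n ^ 2) → K (p * (n + 1)) p j)) := by
  obtain ⟨e⟩ := nonempty_pi_linearEquiv_prod_directSum_of_symm (τ := Fin n × Fin n) hp
    (M := fun t : (Fin n × Fin n) × Fin p => Coker (mulBlock (t.1.1.succ, t.1.2.succ, t.2)))
    (F := K (p * (n + 1)) p) (fun t => nonempty_coker_mulBlock_succ_succ_linearEquiv t.1 t.2)
    (fun _ => nonempty_K_sub_linearEquiv _) (a := n ^ 2) (by simp [sq])
  obtain ⟨f⟩ := nonempty_K_zero_linearEquiv (p * (n + 1)) p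
  exact ⟨e ≪≫ₗ (LinearEquiv.funCongrLeft _ _ (finCongr (sq_eq_two_mul_choose_two_add n).symm) ≪≫ₗ
    (finFunProdEquiv _ _ _ _).symm ≪≫ₗ
    (LinearEquiv.refl _ _).prodCongr (.piCongrRight fun _ => f)).prodCongr (.refl _ _) ≪≫ₗ
    .prodAssoc _ _ _ _⟩

theorem nonempty_quotient_linearEquiv (n : ℕ) (hp : Odd p) :
    Nonempty ((S ⧸ Ideal.span {varX * varY * (varX ^ (p * (n + 1)) - varY ^ (p * (n + 1)))})
      ≃ₗ[R (p * (n + 1)) p]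
        (⨁ j : Finset.Icc 1 p, (Fin (2 * n) → X (p * (n + 1)) p j)) ×
        (⨁ j : Finset.Icc 1 ((p - 1) / 2), (Fin 2 → N (p * (n + 1)) p j)) ×
        (⨁ j : Finset.Icc 1 ((p - 1) / 2), (Fin (2 * n ^ 2) → K (p * (n + 1)) p j)) ×
        (Fin (2 * n.choose 2) → K (p * (n + 1)) p 0) ×
        (R (p * (n + 1)) p ⧸ Ideal.span {σ₁ (p * (n + 1)) p}) ×
        (Fin n → R (p * (n + 1)) p ⧸
          Ideal.span {σ₂ (p * (n + 1)) p ^ 2 - 4 * σ₁ (p * (n + 1)) p ^ p}) ×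
        (R (p * (n + 1)) p ⧸ Ideal.span {Δ (p * (n + 1)) p})) := by
  have : NeZero p := ⟨hp.pos.ne'⟩
  obtain ⟨e⟩ := nonempty_quotient_linearEquiv_pi_coker_mulBlock p n
  obtain ⟨eN⟩ := nonempty_pi_coker_mulBlock_zero_zero_linearEquiv n hp
  obtain ⟨eX⟩ := nonempty_pi_coker_mulBlock_prod_linearEquiv p n
  obtain ⟨eK⟩ := nonempty_pi_coker_mulBlock_succ_succ_linearEquiv n hp
  exact ⟨e ≪≫ₗ piFinSuccFinSucc _ ≪≫ₗ eN.prodCongr (eX.prodCongr eK) ≪≫ₗ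
    prodSortEquiv _ _ _ _ _ _ _ _⟩

theorem nonempty_quotient_linearEquiv_of_K_zero (n : ℕ) (hp : Odd p) :
    Nonempty ((S ⧸ Ideal.span {varX * varY * (varX ^ (p * (n + 1)) - varY ^ (p * (n + 1)))})
      ≃ₗ[R (p * (n + 1)) p]
        (⨁ j : Finset.Icc 1 p, (Fin (2 * n) → X (p * (n + 1)) p j)) ×
        (⨁ j : Finset.Icc 1 ((p - 1) / 2), (Fin 2 → N (p * (n + 1)) p j)) ×
        (⨁ j : Finset.Icc 1 ((p - 1) / 2), (Fin (2 * n ^ 2) → K (p * (n + 1)) p j)) ×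
        (R (p * (n + 1)) p ⧸ Ideal.span {σ₁ (p * (n + 1)) p}) ×
        (Fin (n + 2 * n.choose 2) → R (p * (n + 1)) p ⧸
          Ideal.span {σ₂ (p * (n + 1)) p ^ 2 - 4 * σ₁ (p * (n + 1)) p ^ p}) ×
        (R (p * (n + 1)) p ⧸ Ideal.span {Δ (p * (n + 1)) p})) := by
  obtain ⟨e⟩ := nonempty_quotient_linearEquiv n hp
  obtain ⟨f⟩ := nonempty_K_zero_linearEquiv (p * (n + 1)) p
  exact ⟨e ≪≫ₗ prodMergeEquiv _ _ _ _ _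
    ((LinearEquiv.refl _ _).prodCongr (.piCongrRight fun _ => f) ≪≫ₗ finFunProdEquiv _ _ _ _)⟩

theorem isoOverQuotient_of_linearEquiv {A M M' : Type*} [CommRing A] {I : Ideal A}
    [AddCommGroup M] [Module A M] [AddCommGroup M'] [Module A M']
    (h : Module.IsTorsionBySet A M I) (e : M ≃ₗ[A] M') : IsoOverQuotient I M M' := by
  have h' : Module.IsTorsionBySet A M' I := fun x a => e.symm.injective <| by
    rw [map_smul, map_zero]
    exact @h _ a
  let := h.module
  let := h'.module
  have : IsScalarTower A (A ⧸ I) M := h.isScalarTower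
  have : IsScalarTower A (A ⧸ I) M' := h'.isScalarTower
  exact ⟨h, h', ⟨e.extendScalarsOfSurjective Ideal.Quotient.mk_surjective⟩⟩

end Decomposition

/-! ### Reflecting hyperplanes -/

section Hyperplanes

variable {n : ℕ}

/-- The linear form `∑ i, cᵢ xᵢ`. -/
def linearForm (c : Fin n → ℂ) : MvPolynomial (Fin n) ℂ := ∑ i, C (c i) * MvPolynomial.X i

/-- The kernel of the linear form with coefficients `c`; it is a hyperplane only if `c ≠ 0`. -/
def hyperplane (c : Fin n → ℂ) : Submodule ℂ (Fin n → ℂ) :=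
  LinearMap.ker (Fintype.linearCombination ℂ c)

theorem mem_hyperplane {c v : Fin n → ℂ} : v ∈ hyperplane c ↔ c ⬝ᵥ v = 0 := by
  simp [hyperplane, Fintype.linearCombination_apply, dotProduct, mul_comm]

theorem eval_linearForm (c v : Fin n → ℂ) : MvPolynomial.eval v (linearForm c) = c ⬝ᵥ v := by
  simp [linearForm, dotProduct]

theorem finrank_hyperplane_add_one {c : Fin n → ℂ} (hc : c ≠ 0) :
    Module.finrank ℂ (hyperplane c) + 1 = n := by
  have hne : Fintype.linearCombination ℂ c ≠ 0 := fun h => hc <| funext fun i => by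
    simpa using congrArg (· (Pi.single i 1)) h
  exact (Module.Dual.finrank_ker_add_one_of_ne_zero hne).trans (Module.finrank_fin_fun ℂ)

theorem eq_hyperplane_of_le {W : Submodule ℂ (Fin n → ℂ)} (hW : Module.finrank ℂ W + 1 = n)
    {c : Fin n → ℂ} (hc : c ≠ 0) (h : W ≤ hyperplane c) : W = hyperplane c :=
  Submodule.eq_of_le_of_finrank_eq h <|
    Nat.add_right_cancel (hW.trans (finrank_hyperplane_add_one hc).symm)

theorem mem_span_singleton_of_hyperplane_le {c d : Fin n → ℂ} (h : hyperplane c ≤ hyperplane d) :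
    d ∈ Submodule.span ℂ {c} := by
  have hmem : Fintype.linearCombination ℂ d ∈ Submodule.span ℂ
      (Set.range fun _ : Unit => Fintype.linearCombination ℂ c) :=
    mem_span_of_iInf_ker_le_ker (by simpa [hyperplane] using h)
  rw [Set.range_const, Submodule.mem_span_singleton] at hmem
  obtain ⟨a, ha⟩ := hmem
  refine Submodule.mem_span_singleton.2 ⟨a, funext fun i => ?_⟩
  simpa using congrArg (· (Pi.single i 1)) ha

theorem exists_units_smul_eq_of_hyperplane_eq {c d : Fin n → ℂ}
    (h : hyperplane c = hyperplane d) : ∃ u : ℂˣ, u • c = d := by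
  refine Submodule.span_singleton_eq_span_singleton.1 (le_antisymm ?_ ?_) <;>
    rw [Submodule.span_singleton_le_iff_mem]
  exacts [mem_span_singleton_of_hyperplane_le h.ge, mem_span_singleton_of_hyperplane_le h.le]

theorem IsDefiningForm.associated_linearForm {c : Fin n → ℂ} {l : MvPolynomial (Fin n) ℂ}
    (hl : IsDefiningForm (hyperplane c) l) : Associated l (linearForm c) := by
  obtain ⟨hhom, hker⟩ := hl
  rw [← MvPolynomial.mem_homogeneousSubmodule, MvPolynomial.homogeneousSubmodule_one_eq_span_X,
    Submodule.mem_span_range_iff_exists_fun] at hhom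
  obtain ⟨s, hs⟩ := hhom
  obtain rfl : linearForm s = l := by simpa [linearForm, MvPolynomial.smul_eq_C_mul] using hs
  obtain ⟨u, rfl⟩ := exists_units_smul_eq_of_hyperplane_eq (c := s) (d := c) <| by
    ext v
    rw [hker, eval_linearForm, mem_hyperplane]
  refine ⟨u.map C.toMonoidHom, ?_⟩
  simp [linearForm, Finset.mul_sum, Units.smul_def, mul_comm (_ : MvPolynomial _ _) (C (u : ℂ)),
    mul_assoc]

theorem linearForm_single (k : Fin n) : linearForm (Pi.single k 1) = MvPolynomial.X k := by
  simp [linearForm, Pi.single_apply, apply_ite C]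

theorem linearForm_one_neg (ζ : ℂ) : linearForm ![1, -ζ] = varX - C ζ * varY := by
  simp [linearForm, sub_eq_add_neg]

theorem mem_hyperplane_single {k : Fin n} {v : Fin n → ℂ} :
    v ∈ hyperplane (Pi.single k 1) ↔ v k = 0 := by
  simp [mem_hyperplane]

theorem mem_hyperplane_one_neg {ζ : ℂ} {v : Fin 2 → ℂ} :
    v ∈ hyperplane ![1, -ζ] ↔ v 0 = ζ * v 1 := by
  simp [mem_hyperplane, dotProduct, ← sub_eq_add_neg, sub_eq_zero]

theorem monomialGL_fixes_hyperplane_single_iff {σ : Equiv.Perm (Fin n)} {u : Fin n → ℂˣ}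
    {k : Fin n} :
    (∀ v ∈ hyperplane (Pi.single k 1),
      (monomialGL σ u : Matrix (Fin n) (Fin n) ℂ).mulVec v = v) ↔
    σ = 1 ∧ Pi.mulSingle k (u k) = u := by
  constructor
  · intro hfix
    have hne (j) (hj : j ≠ k) : σ j = j ∧ u j = 1 := by
      have h := congrFun (hfix (Pi.single j 1) (mem_hyperplane_single.2 (by simp [hj.symm]))) j
      rw [monomialGL_mulVec, Pi.single_eq_same] at h
      have hσ : σ j = j := by
        by_contra hσ
        simp [Pi.single_eq_of_ne hσ] at h
      exact ⟨hσ, by simpa [hσ] using h⟩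
    refine ⟨Equiv.ext fun j => ?_, funext fun j => ?_⟩ <;> by_cases hj : j = k
    · subst hj
      by_contra hσ
      exact hσ (σ.injective (hne _ hσ).1)
    · exact (hne j hj).1
    · rw [hj, Pi.mulSingle_eq_same]
    · rw [Pi.mulSingle_eq_of_ne hj, (hne j hj).2]
  · rintro ⟨rfl, hu⟩ v hv
    ext i
    rw [mem_hyperplane_single] at hv
    rw [monomialGL_mulVec, ← hu]
    by_cases hi : i = k
    · simp [hi, hv]
    · simp [hi]

variable {p q : ℕ}

theorem mem_G_and_fixes_hyperplane_single_iff [NeZero p] [NeZero q] {k : Fin n}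
    {g : GL (Fin n) ℂ} :
    (g ∈ G (p * q) p n ∧
      ∀ v ∈ hyperplane (Pi.single k 1), (g : Matrix (Fin n) (Fin n) ℂ).mulVec v = v) ↔
    ∃ a : rootsOfUnity q ℂ, monomialGL 1 (Pi.mulSingle k (a : ℂˣ)) = g := by
  have hdiv : p * q / p = q := Nat.mul_div_cancel_left q (NeZero.pos p)
  constructor
  · rintro ⟨hg, hfix⟩
    obtain ⟨σ, u, -, hdet, rfl⟩ := mem_G_iff.1 hg
    obtain ⟨rfl, hu⟩ := monomialGL_fixes_hyperplane_single_iff.1 hfix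
    rw [← hu, Finset.prod_pi_mulSingle', if_pos (Finset.mem_univ k), hdiv] at hdet
    exact ⟨⟨u k, hdet⟩, by rw [hu]⟩
  · rintro ⟨⟨a, ha : a ^ q = 1⟩, rfl⟩
    refine ⟨mem_G_iff.2 ⟨1, _, fun i => ?_, ?_, rfl⟩,
      monomialGL_fixes_hyperplane_single_iff.2 ⟨rfl, by simp⟩⟩
    · by_cases hi : i = k
      · subst hi
        simp [pow_mul', ha]
      · simp [hi]
    · simpa [hdiv] using ha

theorem fixerOrder_hyperplane_single [NeZero p] [NeZero q] (k : Fin n) :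
    fixerOrder (G (p * q) p n) (hyperplane (Pi.single k 1)) = q := by
  have hinj : Function.Injective fun a : rootsOfUnity q ℂ =>
      monomialGL 1 (Pi.mulSingle k (a : ℂˣ)) :=
    monomialGL_one_injective.comp ((Pi.mulSingle_injective k).comp Subtype.val_injective)
  calc fixerOrder (G (p * q) p n) (hyperplane (Pi.single k 1))
      = Nat.card (Set.range fun a : rootsOfUnity q ℂ => monomialGL 1 (Pi.mulSingle k (a : ℂˣ))) :=
        Nat.card_congr (Equiv.subtypeEquivRight fun _ => mem_G_and_fixes_hyperplane_single_iff)
    _ = q := by rw [Nat.card_range_of_injective hinj, Complex.card_rootsOfUnity]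

theorem hyperplane_single_mem_hyperplanes [NeZero p] (hq : 1 < q) (k : Fin n) :
    hyperplane (Pi.single k 1) ∈ hyperplanes (G (p * q) p n) := by
  have : NeZero q := ⟨by omega⟩
  obtain ⟨ζ, hζ⟩ := exists_units_isPrimitiveRoot q
  obtain ⟨hmem, hfix⟩ := mem_G_and_fixes_hyperplane_single_iff (p := p) (k := k).2
    ⟨⟨ζ, hζ.pow_eq_one⟩, rfl⟩
  refine ⟨finrank_hyperplane_add_one (by simp), _, hmem, fun h => hζ.ne_one hq ?_, hfix⟩
  rw [← monomialGL_one_one] at h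
  simpa using monomialGL_one_injective h

end Hyperplanes

section Mirrors

theorem perm_fin_two_eq (σ : Equiv.Perm (Fin 2)) : σ = 1 ∨ σ = Equiv.swap 0 1 := by
  decide +revert

theorem monomialGL_fixes_hyperplane_one_neg_iff {ζ : ℂˣ} {σ : Equiv.Perm (Fin 2)}
    {u : Fin 2 → ℂˣ} :
    (∀ v ∈ hyperplane ![1, -(ζ : ℂ)],
      (monomialGL σ u : Matrix (Fin 2) (Fin 2) ℂ).mulVec v = v) ↔
    σ = 1 ∧ u = 1 ∨ σ = Equiv.swap 0 1 ∧ u = ![ζ⁻¹, ζ] := by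
  constructor
  · intro hfix
    have h := hfix ![(ζ : ℂ), 1] (mem_hyperplane_one_neg.2 (by simp))
    have h₀ := congrFun h 0
    have h₁ := congrFun h 1
    rw [monomialGL_mulVec] at h₀ h₁
    obtain rfl | rfl := perm_fin_two_eq σ
    · refine Or.inl ⟨rfl, funext fun i => ?_⟩
      fin_cases i
      · simpa using h₀
      · simpa using h₁
    · refine Or.inr ⟨rfl, funext fun i => Units.ext ?_⟩
      fin_cases i
      · simpa using eq_inv_of_mul_eq_one_left h₁
      · simpa using h₀
  · rintro (⟨rfl, rfl⟩ | ⟨rfl, rfl⟩) v hv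
    · simp [monomialGL_one_one]
    · rw [mem_hyperplane_one_neg] at hv
      ext i
      rw [monomialGL_mulVec]
      fin_cases i <;> simp [hv]

theorem mem_G_and_fixes_hyperplane_one_neg_iff {m p : ℕ} [NeZero m] {ζ : ℂˣ} (hζ : ζ ^ m = 1)
    {g : GL (Fin 2) ℂ} :
    (g ∈ G m p 2 ∧
      ∀ v ∈ hyperplane ![1, -(ζ : ℂ)], (g : Matrix (Fin 2) (Fin 2) ℂ).mulVec v = v) ↔
    g ∈ ({1, monomialGL (Equiv.swap 0 1) ![ζ⁻¹, ζ]} : Set _) := by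
  constructor
  · rintro ⟨hg, hfix⟩
    obtain ⟨σ, u, -, -, rfl⟩ := mem_G_iff.1 hg
    obtain ⟨rfl, rfl⟩ | ⟨rfl, rfl⟩ := monomialGL_fixes_hyperplane_one_neg_iff.1 hfix
    · exact Or.inl monomialGL_one_one
    · exact Or.inr rfl
  · rintro (rfl | rfl)
    · exact ⟨one_mem _, by simp⟩
    · refine ⟨mem_G_iff.2 ⟨_, _, fun i => ?_, by simp, rfl⟩,
        monomialGL_fixes_hyperplane_one_neg_iff.2 (Or.inr ⟨rfl, rfl⟩)⟩
      fin_cases i <;> simp [hζ]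

theorem fixerOrder_hyperplane_one_neg {m : ℕ} (p : ℕ) [NeZero m] {ζ : ℂˣ} (hζ : ζ ^ m = 1) :
    fixerOrder (G m p 2) (hyperplane ![1, -(ζ : ℂ)]) = 2 :=
  (Nat.card_congr (Equiv.subtypeEquivRight fun _ =>
    mem_G_and_fixes_hyperplane_one_neg_iff hζ)).trans
    (Set.ncard_pair (monomialGL_swap_ne_one _).symm)

theorem hyperplane_one_neg_mem_hyperplanes {m : ℕ} (p : ℕ) [NeZero m] {ζ : ℂˣ} (hζ : ζ ^ m = 1) :
    hyperplane ![1, -(ζ : ℂ)] ∈ hyperplanes (G m p 2) := by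
  obtain ⟨hmem, hfix⟩ := (mem_G_and_fixes_hyperplane_one_neg_iff (p := p) hζ).2 (Or.inr rfl)
  exact ⟨finrank_hyperplane_add_one (by simp), _, hmem, monomialGL_swap_ne_one _, hfix⟩

theorem eq_hyperplane_of_mem_hyperplanes {m p : ℕ} [NeZero m] {W : Submodule ℂ (Fin 2 → ℂ)}
    (hW : W ∈ hyperplanes (G m p 2)) :
    (∃ i, hyperplane (Pi.single i 1) = W) ∨
      ∃ ζ : ℂˣ, ζ ^ m = 1 ∧ hyperplane ![1, -(ζ : ℂ)] = W := by
  obtain ⟨hrank, g, hg, hg1, hfix⟩ := hW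
  obtain ⟨σ, u, hu, -, rfl⟩ := mem_G_iff.1 hg
  have hfix' (v) (hv : v ∈ W) (i) : u (σ i) * v (σ i) = v i := by
    rw [← monomialGL_mulVec, hfix v hv]
  obtain rfl | rfl := perm_fin_two_eq σ
  · obtain ⟨i, hi⟩ : ∃ i, u i ≠ 1 := by
      by_contra! h
      exact hg1 (by rw [show u = 1 from funext h, monomialGL_one_one])
    refine Or.inl ⟨i, (eq_hyperplane_of_le hrank (by simp) fun v hv => ?_).symm⟩
    rw [mem_hyperplane_single]
    by_contra hvi
    exact hi (Units.ext (mul_eq_right₀ hvi |>.1 (hfix' v hv i)))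
  · refine Or.inr ⟨u 1, hu 1, (eq_hyperplane_of_le hrank (by simp) fun v hv => ?_).symm⟩
    rw [mem_hyperplane_one_neg]
    simpa using (hfix' v hv 0).symm

/-- The kernels of the linear forms `x`, `y` and `x - ζ y`, where `ζ` runs through the `m`-th roots
of unity: these are the reflecting hyperplanes of `G(m,p,2)`, `p < m`. -/
def mirror (m : ℕ) : Fin 2 ⊕ rootsOfUnity m ℂ → Submodule ℂ (Fin 2 → ℂ) :=
  Sum.elim (fun i => hyperplane (Pi.single i 1)) fun ζ => hyperplane ![1, -((ζ : ℂˣ) : ℂ)]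

theorem mirror_injective (m : ℕ) : Function.Injective (mirror m) := by
  refine Function.Injective.sumElim (fun i j hij => ?_) (fun ζ ζ' hζ => ?_) fun i ζ hiζ => ?_
  · have h : Pi.single i 1 ∉ hyperplane (Pi.single i 1) := by simp [mem_hyperplane_single]
    rw [hij, mem_hyperplane_single] at h
    by_contra hne
    exact h (Pi.single_eq_of_ne' hne 1)
  · have h : ![((ζ : ℂˣ) : ℂ), 1] ∈ hyperplane ![1, -((ζ : ℂˣ) : ℂ)] := by
      simp [mem_hyperplane_one_neg]
    rw [hζ, mem_hyperplane_one_neg] at h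
    exact Subtype.ext (Units.ext (by simpa using h))
  · have h : ![((ζ : ℂˣ) : ℂ), 1] ∈ hyperplane ![1, -((ζ : ℂˣ) : ℂ)] := by
      simp [mem_hyperplane_one_neg]
    rw [← hiζ, mem_hyperplane_single] at h
    fin_cases i <;> simp at h

theorem range_mirror {p q : ℕ} [NeZero p] (hq : 1 < q) :
    Set.range (mirror (p * q)) = hyperplanes (G (p * q) p 2) := by
  have : NeZero q := ⟨by omega⟩
  apply Set.Subset.antisymm
  · rintro _ ⟨i | ⟨ζ, hζ⟩, rfl⟩
    · exact hyperplane_single_mem_hyperplanes hq i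
    · exact hyperplane_one_neg_mem_hyperplanes p hζ
  · intro W hW
    obtain ⟨i, rfl⟩ | ⟨ζ, hζ, rfl⟩ := eq_hyperplane_of_mem_hyperplanes hW
    · exact ⟨Sum.inl i, rfl⟩
    · exact ⟨Sum.inr ⟨ζ, hζ⟩, rfl⟩

theorem finprod_mem_hyperplanes {M : Type*} [CommMonoid M] {p q : ℕ} [NeZero p]
    [Fintype (rootsOfUnity (p * q) ℂ)] (hq : 1 < q) (F : Submodule ℂ (Fin 2 → ℂ) → M) :
    ∏ᶠ W ∈ hyperplanes (G (p * q) p 2), F W =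
      (∏ i : Fin 2, F (hyperplane (Pi.single i 1))) *
        ∏ ζ : rootsOfUnity (p * q) ℂ, F (hyperplane ![1, -((ζ : ℂˣ) : ℂ)]) := by
  rw [← range_mirror hq, finprod_mem_range (mirror_injective _),
    finprod_eq_prod_of_fintype, Fintype.prod_sum_type]
  rfl

theorem prod_rootsOfUnity_sub_algebraMap_mul {k A : Type*} [CommRing k] [IsDomain k] [CommRing A]
    [IsDomain A] [Algebra k A] [FaithfulSMul k A] {m : ℕ} [NeZero m]
    [Fintype (rootsOfUnity m k)] {ω : k}
    (hω : IsPrimitiveRoot ω m) (a b : A) :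
    ∏ ζ : rootsOfUnity m k, (a - algebraMap k A (ζ : kˣ) * b) = a ^ m - b ^ m := by
  have hinj := FaithfulSMul.algebraMap_injective k A
  have hω' := hω.map_of_injective hinj
  have hmem (ζ : rootsOfUnity m k) :
      algebraMap k A (ζ : kˣ) ∈ Polynomial.nthRootsFinset m (1 : A) :=
    (Polynomial.mem_nthRootsFinset (NeZero.pos m) 1).2 (by
      rw [← map_pow, ← Units.val_pow_eq_pow_val, ζ.2, Units.val_one, map_one])
  have hinj' : Function.Injective fun ζ : rootsOfUnity m k => algebraMap k A (ζ : kˣ) :=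
    hinj.comp (Units.val_injective.comp Subtype.val_injective)
  rw [hω'.pow_sub_pow_eq_prod_sub_mul _ _ (NeZero.pos m)]
  refine Finset.prod_nbij _ (fun ζ _ => hmem ζ) hinj'.injOn ?_ fun _ _ => rfl
  refine Finset.surjOn_of_injOn_of_card_le _ (fun ζ _ => hmem ζ) hinj'.injOn ?_
  rw [hω'.card_nthRootsFinset, Finset.card_univ, ← Nat.card_eq_fintype_card, hω.card_rootsOfUnity]

theorem prod_rootsOfUnity_linearForm (m : ℕ) [NeZero m] [Fintype (rootsOfUnity m ℂ)] :
    ∏ ζ : rootsOfUnity m ℂ, linearForm ![1, -((ζ : ℂˣ) : ℂ)] = varX ^ m - varY ^ m := by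
  simp only [linearForm_one_neg]
  exact prod_rootsOfUnity_sub_algebraMap_mul (Complex.isPrimitiveRoot_exp m (NeZero.ne m)) _ _

theorem prod_linearForm_single : ∏ i : Fin 2, linearForm (Pi.single i 1) = varX * varY := by
  simp [linearForm_single]

variable {p q : ℕ} [NeZero p] {α : Submodule ℂ (Fin 2 → ℂ) → S}

theorem associated_arrangementPoly (hq : 1 < q)
    (hα : ∀ W ∈ hyperplanes (G (p * q) p 2), IsDefiningForm W (α W)) :
    Associated (arrangementPoly (G (p * q) p 2) α)
      (varX * varY * (varX ^ (p * q) - varY ^ (p * q))) := by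
  have : NeZero q := ⟨by omega⟩
  have := Fintype.ofFinite (rootsOfUnity (p * q) ℂ)
  rw [arrangementPoly, finprod_mem_hyperplanes hq, ← prod_rootsOfUnity_linearForm,
    ← prod_linearForm_single]
  exact (Associated.prod _ _ _ fun i _ =>
    (hα _ (hyperplane_single_mem_hyperplanes hq i)).associated_linearForm).mul_mul
    (Associated.prod _ _ _ fun ζ _ =>
      (hα _ (hyperplane_one_neg_mem_hyperplanes p ζ.2)).associated_linearForm)

theorem associated_discriminantPoly (hq : 1 < q)
    (hα : ∀ W ∈ hyperplanes (G (p * q) p 2), IsDefiningForm W (α W)) :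
    Associated (discriminantPoly (G (p * q) p 2) α)
      ((varX * varY) ^ q * (varX ^ (p * q) - varY ^ (p * q)) ^ 2) := by
  have : NeZero q := ⟨by omega⟩
  have := Fintype.ofFinite (rootsOfUnity (p * q) ℂ)
  rw [discriminantPoly, finprod_mem_hyperplanes hq, ← prod_rootsOfUnity_linearForm,
    ← prod_linearForm_single, ← Finset.prod_pow, ← Finset.prod_pow]
  refine (Associated.prod _ _ _ fun i _ => ?_).mul_mul (Associated.prod _ _ _ fun ζ _ => ?_)
  · rw [fixerOrder_hyperplane_single]
    exact (hα _ (hyperplane_single_mem_hyperplanes hq i)).associated_linearForm.pow_pow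
  · rw [fixerOrder_hyperplane_one_neg p ζ.2]
    exact (hα _ (hyperplane_one_neg_mem_hyperplanes p ζ.2)).associated_linearForm.pow_pow

theorem algebraMap_Δ (p q : ℕ) [NeZero p] :
    algebraMap (R (p * q) p) S (Δ (p * q) p) =
      (varX * varY) ^ q * (varX ^ (p * q) - varY ^ (p * q)) ^ 2 := by
  have h4 : algebraMap (R (p * q) p) S 4 = 4 := map_ofNat _ 4
  rw [Δ, map_mul, map_sub, map_pow, map_mul, map_pow, h4, algebraMap_σ₁, algebraMap_σ₂]
  ring

theorem isTorsionBySet_quotient (p q : ℕ) [NeZero p] [NeZero q] :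
    Module.IsTorsionBySet (R (p * q) p)
      (S ⧸ Ideal.span {varX * varY * (varX ^ (p * q) - varY ^ (p * q))})
      (Ideal.span {Δ (p * q) p} : Ideal (R (p * q) p)) := by
  rw [Module.isTorsionBySet_span_singleton_iff]
  intro x
  obtain ⟨f, rfl⟩ := Ideal.Quotient.mk_surjective x
  refine (Ideal.Quotient.eq_zero_iff_dvd _ (Δ (p * q) p • f)).2 ?_
  rw [Algebra.smul_def, algebraMap_Δ]
  exact Dvd.dvd.mul_right
    (mul_dvd_mul (dvd_pow_self _ (NeZero.ne q)) (dvd_pow_self _ two_ne_zero)) f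

end Mirrors

end ReflGroup

end

open ReflGroup in
theorem mainTheorem5 (m p q : ℕ) (hm : 0 < m) (hq : m = p * q) (hp : Odd p) (hmp : m ≠ p)
    (α : Submodule ℂ (Fin 2 → ℂ) → S)
    (hα : ∀ W ∈ hyperplanes (G m p 2), IsDefiningForm W (α W)) :
    Associated (discriminantPoly (G m p 2) α) (algebraMap (R m p) S (Δ m p)) ∧
    IsoOverQuotient (Ideal.span {Δ m p})
      (S ⧸ Ideal.span {arrangementPoly (G m p 2) α})
      ((⨁ j : Finset.Icc 1 p, (Fin (2 * (q - 1)) → X m p j)) ×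
        (⨁ j : Finset.Icc 1 ((p - 1) / 2), (Fin 2 → N m p j)) ×
        (⨁ j : Finset.Icc 1 ((p - 1) / 2), (Fin (2 * (q - 1) ^ 2) → K m p j)) ×
        (Fin (2 * (q - 1).choose 2) → K m p 0) ×
        (R m p ⧸ Ideal.span {σ₁ m p}) ×
        (Fin (q - 1) → R m p ⧸ Ideal.span {σ₂ m p ^ 2 - 4 * σ₁ m p ^ p}) ×
        (R m p ⧸ Ideal.span {Δ m p})) ∧
    IsoOverQuotient (Ideal.span {Δ m p})
      (S ⧸ Ideal.span {arrangementPoly (G m p 2) α})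
      ((⨁ j : Finset.Icc 1 p, (Fin (2 * (q - 1)) → X m p j)) ×
        (⨁ j : Finset.Icc 1 ((p - 1) / 2), (Fin 2 → N m p j)) ×
        (⨁ j : Finset.Icc 1 ((p - 1) / 2), (Fin (2 * (q - 1) ^ 2) → K m p j)) ×
        (R m p ⧸ Ideal.span {σ₁ m p}) ×
        (Fin (q - 1 + 2 * (q - 1).choose 2) →
          R m p ⧸ Ideal.span {σ₂ m p ^ 2 - 4 * σ₁ m p ^ p}) ×
        (R m p ⧸ Ideal.span {Δ m p})) := by
  subst hq
  obtain ⟨n, rfl⟩ : ∃ n, q = n + 1 := Nat.exists_eq_succ_of_ne_zero (by rintro rfl; simp at hm)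
  have hn : 1 < n + 1 := Nat.succ_lt_succ (Nat.pos_of_ne_zero (by rintro rfl; simp at hmp))
  have : NeZero p := ⟨hp.pos.ne'⟩
  have hz := Ideal.span_singleton_eq_span_singleton.2 (associated_arrangementPoly hn hα)
  have htor := isTorsionBySet_quotient p (n + 1)
  obtain ⟨e⟩ := nonempty_quotient_linearEquiv_of_K_zero n hp
  obtain ⟨f⟩ := nonempty_quotient_linearEquiv n hp
  rw [hz, algebraMap_Δ, Nat.add_sub_cancel]
  exact ⟨associated_discriminantPoly hn hα, isoOverQuotient_of_linearEquiv htor f,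
    isoOverQuotient_of_linearEquiv htor e⟩
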